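/- Let $P\subset\mathbb R^n$ be an $n$-dimensional polytope, and let $X$ be its set of normals, i.e. the set of outer unit normal vectors of its facets ($(n-1)$-dimensional faces). Suppose that $P$ is strongly monotypic: for every $n$-dimensional polytope $Q\subset\mathbb R^n$ with the same set of normals as $P$, the arrangement of the hyperplanes containing the facets of $P$ and the arrangement of the hyperplanes containing the facets of $Q$ are combinatorially equivalent, i.e. there is an incidence-preserving bijection (in both directions) between the faces, of all dimensions, of the two arrangements. Then there are an integer $k\ge 0$ and pairwise disjoint subsets $X_1,\dots,X_k$ of $X$ such that (i) each $X_i$ is the set of vertices of a simplex whose relative interior contains $0$; (ii) the linear spans of $X_1,\dots,X_k$ are linearly independent subspaces of $\mathbb R^n$; (iii) the direct sum of these linear spans is $\mathbb R^n$. -/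

import Mathlib

noncomputable section

namespace StrongMonotypy

/-- `P` is an `n`-dimensional polytope in `ℝⁿ`: the convex hull of finitely many points,
with nonempty interior. -/
def IsPolytope {n : ℕ} (P : Set (EuclideanSpace ℝ (Fin n))) : Prop :=
  (∃ V : Set (EuclideanSpace ℝ (Fin n)), V.Finite ∧ P = convexHull ℝ V) ∧ (interior P).Nonempty

/-- The support function `h_P(u) = sup_{x ∈ P} ⟨u, x⟩`. -/
def support {n : ℕ} (P : Set (EuclideanSpace ℝ (Fin n))) (u : EuclideanSpace ℝ (Fin n)) : ℝ :=
  sSup ((fun x => inner ℝ u x) '' P)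

/-- The hyperplane `{x | ⟨u, x⟩ = h_P(u)}` supporting `P` in direction `u` (for `u ≠ 0`). -/
def supportHyperplane {n : ℕ} (P : Set (EuclideanSpace ℝ (Fin n)))
    (u : EuclideanSpace ℝ (Fin n)) : Set (EuclideanSpace ℝ (Fin n)) :=
  {x | inner ℝ u x = support P u}

/-- The set of normals of `P`: the unit vectors `u` for which the face
of `P` in direction `u` is a facet, that is, a nonempty face of dimension `n - 1`. -/
def normals {n : ℕ} (P : Set (EuclideanSpace ℝ (Fin n))) : Set (EuclideanSpace ℝ (Fin n)) :=
  {u | ‖u‖ = 1 ∧ (P ∩ supportHyperplane P u).Nonempty ∧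
    Module.finrank ℝ (vectorSpan ℝ (P ∩ supportHyperplane P u)) + 1 = n}

/-- The face containing `x` of the arrangement of the hyperplanes containing the facets of `P`:
all points which, for every such hyperplane, lie on it or strictly on one of its two sides
in the same way as `x` does. -/
def arrangementFace {n : ℕ} (P : Set (EuclideanSpace ℝ (Fin n)))
    (x : EuclideanSpace ℝ (Fin n)) : Set (EuclideanSpace ℝ (Fin n)) :=
  {y | ∀ u ∈ normals P,
    SignType.sign (inner ℝ u y - support P u) = SignType.sign (inner ℝ u x - support P u)}

/-- The (relatively open, of all dimensions) faces of the arrangement of the hyperplanes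
containing the facets of `P`; they partition `ℝⁿ`. -/
def arrangementFaces {n : ℕ} (P : Set (EuclideanSpace ℝ (Fin n))) :
    Set (Set (EuclideanSpace ℝ (Fin n))) :=
  Set.range (arrangementFace P)

/-- The facet hyperplane arrangements of `P` and `Q` are combinatorially equivalent: there is a
bijection between their faces that preserves incidence in both directions, where `F` is
a face of `G` when `F` lies in the closure of `G`. -/
def ArrangementsEquivalent {n : ℕ} (P Q : Set (EuclideanSpace ℝ (Fin n))) : Prop :=
  ∃ e : arrangementFaces P ≃ arrangementFaces Q, ∀ F G : arrangementFaces P,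
    (F : Set (EuclideanSpace ℝ (Fin n))) ⊆ closure (G : Set (EuclideanSpace ℝ (Fin n))) ↔
      (e F : Set (EuclideanSpace ℝ (Fin n))) ⊆
        closure (e G : Set (EuclideanSpace ℝ (Fin n)))

/-- An `n`-dimensional polytope `P` is strongly monotypic if for every `n`-dimensional polytope
`Q` with the same set of normals, the arrangements of the hyperplanes containing the facets
of `P` and of `Q` are combinatorially equivalent. -/
def IsStronglyMonotypic {n : ℕ} (P : Set (EuclideanSpace ℝ (Fin n))) : Prop :=
  IsPolytope P ∧
    ∀ Q : Set (EuclideanSpace ℝ (Fin n)), IsPolytope Q → normals Q = normals P →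
      ArrangementsEquivalent P Q

/-- `Y` is the set of vertices of a simplex whose relative interior contains `0`. -/
def IsSimplexAroundZero {n : ℕ} (Y : Set (EuclideanSpace ℝ (Fin n))) : Prop :=
  AffineIndependent ℝ ((↑) : Y → EuclideanSpace ℝ (Fin n)) ∧
    (0 : EuclideanSpace ℝ (Fin n)) ∈ intrinsicInterior ℝ (convexHull ℝ Y)

end StrongMonotypy

end

/-! Fix the normals `v i` of `P` and let the right hand sides `h i` of the inequalities `⟨v i, x⟩ ≤
h i` vary. Every irredundant `h` defines a polytope with exactly these normals, so by strong
monotypy its arrangement is equivalent to that of `P`. Vertices of an arrangement are its minimal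
faces, hence all these arrangements have equally many vertices.

This makes every circuit of the normals one-sided (`hasOneSidedCircuits_of_ncard_vertexSet_eq`). If
a circuit relation `c` had two positive and two negative coefficients, some irredundant `h` would
satisfy `∑ c i * h i = 0` (`IsCircuitRelation.exists_sum_eq_zero`). Two bases of normals would then
define the same vertex, leaving fewer vertices than bases (`IsCircuitRelation.ncard_vertexSet_lt`),
while suitable small perturbations of `h`, still irredundant, have at least as many vertices as
bases (`exists_generic_direction`).

The rest is linear algebra (`exists_nonneg_circuit_decomposition`). Since the normals positively
span, nonnegative circuits exist. Choose one of maximal size and divide by its span; one-sidedness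
and positive spanning survive, so by induction the quotient splits into spans of nonnegative
circuits. One-sidedness and maximality together force these to be circuits in the original space
(`IsCircuitRelation.of_mkQ`). The support of a nonnegative circuit is the vertex set of a simplex
around `0`. -/

open Module

/-! ### Circuit relations and their behaviour in quotients -/

section Circuits

variable {ι V : Type*} [Fintype ι] [AddCommGroup V] [Module ℝ V]

/-- `c` is a nonzero linear relation between the vectors `v i` that is, up to scaling, the only
one on its support: its support is a circuit of the linear matroid of `v`. -/
structure IsCircuitRelation (v : ι → V) (c : ι → ℝ) : Prop where
  ne_zero : c ≠ 0
  sum_eq_zero : ∑ i, c i • v i = 0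
  eq_smul : ∀ c' : ι → ℝ, ∑ i, c' i • v i = 0 → (∀ i, c i = 0 → c' i = 0) → ∃ t : ℝ, c' = t • c

/-- No circuit relation between the vectors `v i` has two positive and two negative
coefficients. -/
def HasOneSidedCircuits (v : ι → V) : Prop :=
  ∀ c, IsCircuitRelation v c →
    (∀ i j, 0 < c i → 0 < c j → i = j) ∨ (∀ i j, c i < 0 → c j < 0 → i = j)

/-- Every linear functional that is nonnegative on all `v i` vanishes. -/
def PositivelySpans (v : ι → V) : Prop :=
  ∀ f : V →ₗ[ℝ] ℝ, (∀ i, 0 ≤ f (v i)) → f = 0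

/-- Subtracting the largest multiple of `e` that keeps `c` nonnegative annihilates a coefficient. -/
lemma exists_sub_smul_nonneg (c e : ι → ℝ) (hc : ∀ i, 0 ≤ c i) (he : ∃ j, 0 < e j) :
    ∃ t : ℝ, 0 ≤ t ∧ (∀ i, 0 ≤ c i - t * e i) ∧ ∃ j, 0 < e j ∧ c j - t * e j = 0 := by
  classical
  obtain ⟨j0, hj0⟩ := he
  obtain ⟨j, hj, hmin⟩ := Finset.exists_min_image (Finset.univ.filter fun j => 0 < e j)
    (fun j => c j / e j) ⟨j0, by simpa using hj0⟩
  simp only [Finset.mem_filter, Finset.mem_univ, true_and] at hj hmin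
  refine ⟨c j / e j, div_nonneg (hc j) hj.le, fun i => ?_, j, hj, by field_simp; simp⟩
  rcases lt_or_ge 0 (e i) with hi | hi
  · have := hmin i hi
    rw [le_div_iff₀ hi] at this
    linarith
  · have : c j / e j * e i ≤ 0 := mul_nonpos_of_nonneg_of_nonpos (div_nonneg (hc j) hj.le) hi
    linarith [hc i]

/-- Shrink the support: as long as another relation lives on it, subtracting a multiple of that
relation kills a coefficient. Keeping `i₀` in the support later excludes circuits consisting of a
single zero vector. -/
lemma exists_isCircuitRelation_of_nonneg (v : ι → V) (i₀ : ι) (c : ι → ℝ) (hc : ∀ i, 0 ≤ c i)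
    (hs : ∑ i, c i • v i = 0) (h₀ : 0 < c i₀) :
    ∃ c', IsCircuitRelation v c' ∧ (∀ i, 0 ≤ c' i) ∧ 0 < c' i₀ := by
  classical
  induction h : (Finset.univ.filter (c · ≠ 0)).card using Nat.strong_induction_on
    generalizing c with
  | _ N ih =>
  by_cases hcirc : IsCircuitRelation v c
  · exact ⟨c, hcirc, hc, h₀⟩
  have hne : c ≠ 0 := fun h => by simp [h] at h₀
  have : ∃ c' : ι → ℝ, ∑ i, c' i • v i = 0 ∧ (∀ i, c i = 0 → c' i = 0) ∧ ∀ t : ℝ, c' ≠ t • c := by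
    by_contra! hcon
    exact hcirc ⟨hne, hs, hcon⟩
  obtain ⟨c', hs', hsupp, hmul⟩ := this
  -- Clearing the coefficient at `i₀` ensures that the reduction leaves `c i₀` untouched.
  set d : ι → ℝ := c' - (c' i₀ / c i₀) • c with hd
  have hd0 : d ≠ 0 := fun h => hmul _ (sub_eq_zero.mp h)
  have hdi : d i₀ = 0 := by simp [hd, h₀.ne']
  have hds : ∑ i, d i • v i = 0 := by
    simp [hd, sub_smul, Finset.sum_sub_distrib, hs', mul_smul, ← Finset.smul_sum, hs]
  have hdsupp : ∀ i, c i = 0 → d i = 0 := fun i hi => by simp [hd, hi, hsupp i hi]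
  obtain ⟨e, he0, hes, hesupp, hepos⟩ : ∃ e : ι → ℝ, e i₀ = 0 ∧ ∑ i, e i • v i = 0 ∧
      (∀ i, c i = 0 → e i = 0) ∧ ∃ j, 0 < e j := by
    obtain ⟨j, hj⟩ := Function.ne_iff.mp hd0
    rcases lt_or_gt_of_ne hj with h | h
    · exact ⟨-d, by simp [hdi], by simp [hds], fun i hi => by simp [hdsupp i hi], j, by simpa using h⟩
    · exact ⟨d, hdi, hds, hdsupp, j, h⟩
  obtain ⟨t, ht, hnn, j, hj, hj0⟩ := exists_sub_smul_nonneg c e hc hepos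
  refine ih _ ?_ (fun i => c i - t * e i) hnn ?_ (by simpa [he0] using h₀) rfl
  · rw [← h]
    apply Finset.card_lt_card
    rw [Finset.ssubset_iff_of_subset]
    · exact ⟨j, by simpa using fun h => hj.ne' (hesupp j h), by simpa using hj0⟩
    · intro i
      simp only [Finset.mem_filter, Finset.mem_univ, true_and]
      intro hi hci
      exact hi (by simp [hci, hesupp i hci])
  · simp [sub_smul, Finset.sum_sub_distrib, hs, mul_smul, ← Finset.smul_sum, hes]

/-- A zero vector would carry a relation on its own, not proportional to `c`. -/
lemma IsCircuitRelation.vector_ne_zero {v : ι → V} {c : ι → ℝ}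
    (hc : IsCircuitRelation v c) {i j : ι} (hij : i ≠ j) (hi : c i ≠ 0) (hj : c j ≠ 0) :
    v i ≠ 0 := by
  classical
  intro h
  obtain ⟨t, ht⟩ := hc.eq_smul (Pi.single i 1) (by simp [Pi.single_apply, h]) (fun k hk => by
    have : k ≠ i := fun h => hi (h ▸ hk)
    simp [this])
  have h1 := congrFun ht i
  have h2 := congrFun ht j
  simp [hij.symm, hj] at h1 h2
  simp [h2] at h1

/-- Coefficients of a vector in the span of a nonnegative circuit may be chosen nonnegative and
vanishing somewhere on the circuit. -/
lemma exists_nonneg_combination {v : ι → V} {c : ι → ℝ} (hc : IsCircuitRelation v c)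
    (hnn : ∀ i, 0 ≤ c i) {w : V} (hw : w ∈ Submodule.span ℝ (v '' {i | c i ≠ 0})) :
    ∃ b : ι → ℝ, (∀ i, 0 ≤ b i) ∧ (∀ i, c i = 0 → b i = 0) ∧ (∃ s, c s ≠ 0 ∧ b s = 0) ∧
      ∑ i, b i • v i = w := by
  classical
  obtain ⟨a, ha, hsupp⟩ : ∃ a : ι → ℝ, ∑ i, a i • v i = w ∧ ∀ i, c i = 0 → a i = 0 := by
    rw [Finsupp.mem_span_image_iff_linearCombination] at hw
    obtain ⟨l, hl, rfl⟩ := hw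
    refine ⟨l, ?_, fun i hi => ?_⟩
    · rw [Finsupp.linearCombination_apply, Finsupp.sum_fintype _ _ (by simp)]
    · by_contra h
      exact (Finsupp.mem_supported _ _).mp hl (Finsupp.mem_support_iff.mpr h) hi
  obtain ⟨j, hj⟩ := Function.ne_iff.mp hc.ne_zero
  -- Subtracting the smallest ratio `a s / c s` times `c` makes all coefficients nonnegative and the
  -- one at `s` zero.
  obtain ⟨s, hs, hmin⟩ := Finset.exists_min_image (Finset.univ.filter fun j => c j ≠ 0)
    (fun j => a j / c j) ⟨j, by simpa using hj⟩
  simp only [Finset.mem_filter, Finset.mem_univ, true_and] at hs hmin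
  refine ⟨fun i => a i - a s / c s * c i, fun i => ?_, fun i hi => by simp [hi, hsupp i hi],
    ⟨s, hs, by simp [hs]⟩, ?_⟩
  · by_cases hi : c i = 0
    · simp [hi, hsupp i hi]
    · have := hmin i hi
      rw [le_div_iff₀ (lt_of_le_of_ne (hnn i) (Ne.symm hi))] at this
      linarith
  · simp [sub_smul, Finset.sum_sub_distrib, mul_smul, ← Finset.smul_sum, hc.sum_eq_zero, ha]

/-- A circuit relation modulo the span of a circuit, completed by a combination of a proper part
of that circuit, is a circuit relation. -/
lemma IsCircuitRelation.add_of_mkQ {v : ι → V} {c μ b : ι → ℝ} (hc : IsCircuitRelation v c)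
    (hμ : IsCircuitRelation
      ((Submodule.span ℝ (v '' {i | c i ≠ 0})).mkQ ∘ v) μ)
    (hdisj : ∀ i, c i ≠ 0 → μ i = 0) (hb : ∀ i, c i = 0 → b i = 0)
    (hs : ∃ s, c s ≠ 0 ∧ b s = 0) (hsum : ∑ i, (μ + b) i • v i = 0) :
    IsCircuitRelation v (μ + b) := by
  classical
  obtain ⟨s, hs, hbs⟩ := hs
  have hμ0 : ∀ i, (μ + b) i = 0 → μ i = 0 := fun i hi => by
    by_cases hci : c i = 0
    · simpa [hb i hci] using hi
    · exact hdisj i hci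
  refine ⟨fun h => hμ.ne_zero (funext fun i => hμ0 i (congrFun h i)), hsum, fun c' hc' hsupp => ?_⟩
  have hmem : ∀ i, c i ≠ 0 → (Submodule.span ℝ (v '' {i | c i ≠ 0})).mkQ (v i) = 0 := fun i hi => by
    rw [Submodule.mkQ_apply, Submodule.Quotient.mk_eq_zero]
    exact Submodule.subset_span ⟨i, hi, rfl⟩
  obtain ⟨t, ht⟩ := hμ.eq_smul (fun i => if c i = 0 then c' i else 0) (by
      rw [← map_zero (Submodule.mkQ _), ← hc', map_sum]
      refine Finset.sum_congr rfl fun i _ => ?_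
      by_cases hi : c i = 0
      · simp [hi]
      · simp [hi, hmem i hi, -Submodule.mkQ_apply]) (fun i hi => by
      by_cases hci : c i = 0
      · simp [hci, hsupp i (by simp [hi, hb i hci])]
      · simp [hci])
  refine ⟨t, ?_⟩
  -- The remainder is supported on the circuit of `c`, hence is a multiple of `c`; it vanishes at
  -- `s` and `c` does not, so it is zero.
  obtain ⟨r, hr⟩ := hc.eq_smul (c' - t • (μ + b)) (by
      simp only [Pi.sub_apply, Pi.smul_apply, smul_eq_mul, sub_smul, Finset.sum_sub_distrib,
        mul_smul, ← Finset.smul_sum, hc', hsum, smul_zero, sub_zero]) (fun i hi => by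
      have := congrFun ht i
      simp [hi] at this
      simp [this, hb i hi])
  have h1 := congrFun hr s
  have : c' s = 0 := hsupp s (by simp [hdisj s hs, hbs])
  simp [this, hdisj s hs, hbs, hs] at h1
  rw [h1, zero_smul] at hr
  exact sub_eq_zero.mp hr

/-- A circuit of the quotient with at least two elements lifts to a circuit that keeps all its
nonzero coefficients, so a violation of one-sidedness would lift as well. -/
lemma HasOneSidedCircuits.mkQ {v : ι → V} (hv : HasOneSidedCircuits v) {c : ι → ℝ}
    (hc : IsCircuitRelation v c) (hnn : ∀ i, 0 ≤ c i) :
    HasOneSidedCircuits ((Submodule.span ℝ (v '' {i | c i ≠ 0})).mkQ ∘ v) := by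
  intro μ hμ
  by_cases hsing : ∀ i j, μ i ≠ 0 → μ j ≠ 0 → i = j
  · exact Or.inl fun i j hi hj => hsing i j hi.ne' hj.ne'
  push Not at hsing
  obtain ⟨i, j, hi, hj, hij⟩ := hsing
  have hdisj : ∀ k, c k ≠ 0 → μ k = 0 := by
    intro k hk
    by_contra hμk
    obtain ⟨l, hl, hkl⟩ : ∃ l, μ l ≠ 0 ∧ k ≠ l := by
      by_cases h : k = i
      · exact ⟨j, hj, h ▸ hij⟩
      · exact ⟨i, hi, h⟩
    refine hμ.vector_ne_zero hkl hμk hl ?_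
    simp only [Function.comp_apply, Submodule.mkQ_apply, Submodule.Quotient.mk_eq_zero]
    exact Submodule.subset_span ⟨k, hk, rfl⟩
  have hw : -∑ i, μ i • v i ∈ Submodule.span ℝ (v '' {i | c i ≠ 0}) := by
    rw [Submodule.neg_mem_iff, ← Submodule.Quotient.mk_eq_zero, ← Submodule.mkQ_apply, map_sum]
    simpa using hμ.sum_eq_zero
  obtain ⟨b, -, hb, hs, hsum⟩ := exists_nonneg_combination hc hnn hw
  have hcirc := hc.add_of_mkQ hμ hdisj hb hs (by
    simp [add_smul, Finset.sum_add_distrib, hsum])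
  have hval : ∀ k, μ k ≠ 0 → (μ + b) k = μ k := fun k hk => by
    have : c k = 0 := by
      by_contra h
      exact hk (hdisj k h)
    simp [hb k this]
  rcases hv _ hcirc with h | h
  · exact Or.inl fun i j hi hj => h i j (by rwa [hval i hi.ne']) (by rwa [hval j hj.ne'])
  · exact Or.inr fun i j hi hj => h i j (by rwa [hval i hi.ne]) (by rwa [hval j hj.ne])

end Circuits

/-! ### Decomposition into spans of nonnegative circuits -/

section Decomposition

lemma PositivelySpans.mkQ {ι V : Type*} [AddCommGroup V] [Module ℝ V] {v : ι → V}
    (hv : PositivelySpans v) (W : Submodule ℝ V) : PositivelySpans (W.mkQ ∘ v) := by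
  intro f hf
  have := hv (f ∘ₗ W.mkQ) hf
  exact Submodule.linearMap_qext _ (by simpa using this)

lemma iSupIndep_of_sum_eq_zero {κ R V : Type*} [Fintype κ] [Ring R] [AddCommGroup V] [Module R V]
    {p : κ → Submodule R V}
    (h : ∀ x : κ → V, (∀ a, x a ∈ p a) → ∑ a, x a = 0 → ∀ a, x a = 0) : iSupIndep p := by
  classical
  rw [iSupIndep_iff_finsetSum_eq_zero_imp_eq_zero]
  intro s x hx hsum a ha
  have := h (fun a => if a ∈ s then x a else 0) (fun a => by
    by_cases ha : a ∈ s
    · simpa [ha] using hx a ha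
    · simp [ha]) (by simpa using hsum) a
  simpa [ha] using this

variable {ι : Type*} [Fintype ι]

lemma exists_weights_of_mem_convexHull {V : Type*} [AddCommGroup V] [Module ℝ V] (v : ι → V)
    (p : ι → Prop) {x : V} (hx : x ∈ convexHull ℝ (v '' {i | p i})) :
    ∃ c : ι → ℝ, (∀ i, 0 ≤ c i) ∧ (∀ i, ¬ p i → c i = 0) ∧ ∑ i, c i = 1 ∧ ∑ i, c i • v i = x := by
  classical
  refine convexHull_min (t := {x | ∃ c : ι → ℝ, (∀ i, 0 ≤ c i) ∧ (∀ i, ¬ p i → c i = 0) ∧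
    ∑ i, c i = 1 ∧ ∑ i, c i • v i = x}) ?_ ?_ hx
  · rintro _ ⟨i, hi, rfl⟩
    refine ⟨Pi.single i 1, fun j => ?_, fun j hj => ?_, by simp, by simp [Pi.single_apply]⟩
    · by_cases h : j = i
      · subst h; simp
      · simp [h]
    · have : j ≠ i := fun h => hj (h ▸ hi)
      simp [this]
  · rintro _ ⟨c, hc, hcp, hc1, rfl⟩ _ ⟨d, hd, hdp, hd1, rfl⟩ a b ha hb hab
    refine ⟨fun i => a * c i + b * d i, fun i => ?_, fun i hi => by simp [hcp i hi, hdp i hi], ?_, ?_⟩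
    · exact add_nonneg (mul_nonneg ha (hc i)) (mul_nonneg hb (hd i))
    · simp [Finset.sum_add_distrib, ← Finset.mul_sum, hc1, hd1, hab]
    · simp [add_smul, Finset.sum_add_distrib, mul_smul, ← Finset.smul_sum]

/-- If `0` is not in the hull of the nonzero vectors, a separating functional is positive on all of
them, against positive spanning. -/
lemma PositivelySpans.exists_nonneg_relation {V : Type*} [AddCommGroup V] [Module ℝ V]
    [FiniteDimensional ℝ V] [Nontrivial V] {v : ι → V} (hv : PositivelySpans v) :
    ∃ (c : ι → ℝ) (i₀ : ι), (∀ i, 0 ≤ c i) ∧ ∑ i, c i • v i = 0 ∧ 0 < c i₀ ∧ v i₀ ≠ 0 := by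
  classical
  -- `V` carries no topology, as it will be a quotient in the induction; separation is done in
  -- coordinates.
  let e := (finBasis ℝ V).equivFun
  by_cases h0 : (0 : Fin (finrank ℝ V) → ℝ) ∈ convexHull ℝ ((e ∘ v) '' {i | v i ≠ 0})
  · obtain ⟨c, hc, hcp, hc1, hsum⟩ := exists_weights_of_mem_convexHull _ _ h0
    obtain ⟨i₀, -, hi₀⟩ := Finset.exists_ne_zero_of_sum_ne_zero (hc1.trans_ne one_ne_zero)
    refine ⟨c, i₀, hc, ?_, lt_of_le_of_ne (hc i₀) hi₀.symm, fun h => hi₀ (hcp i₀ (by simp [h]))⟩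
    apply e.injective
    simpa using hsum
  · exfalso
    obtain ⟨f, u, hfu, hf⟩ := geometric_hahn_banach_point_closed (convex_convexHull ℝ _)
      (Set.Finite.isClosed_convexHull ℝ (Set.toFinite ((e ∘ v) '' {i | v i ≠ 0}))) h0
    rw [map_zero] at hfu
    have hpos : ∀ i, v i ≠ 0 → 0 < f (e (v i)) := fun i hi =>
      hfu.trans (hf _ (subset_convexHull _ _ ⟨i, hi, rfl⟩))
    have hz := hv (f.toLinearMap ∘ₗ e.toLinearMap) (fun i => by
      by_cases hi : v i = 0
      · simp [hi]
      · exact (hpos i hi).le)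
    have hall : ∀ i, v i = 0 := by
      intro i
      by_contra hi
      exact (hpos i hi).ne' (LinearMap.congr_fun hz (v i))
    obtain ⟨x, hx⟩ := exists_ne (0 : V)
    exact hx ((Module.forall_dual_apply_eq_zero_iff ℝ x).mp fun φ => by
      rw [hv φ fun i => by simp [hall i], LinearMap.zero_apply])

/-- A nonnegative circuit relation modulo the span of a nonnegative circuit of maximal
cardinality is already a circuit relation. -/
lemma IsCircuitRelation.of_mkQ {V : Type*} [AddCommGroup V] [Module ℝ V] {v : ι → V}
    (hv : HasOneSidedCircuits v) {c μ : ι → ℝ} (hc : IsCircuitRelation v c) (hnn : ∀ i, 0 ≤ c i)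
    (hmax : ∀ c', IsCircuitRelation v c' → (∀ i, 0 ≤ c' i) →
      {i | c' i ≠ 0}.ncard ≤ {i | c i ≠ 0}.ncard)
    (hμ : IsCircuitRelation ((Submodule.span ℝ (v '' {i | c i ≠ 0})).mkQ ∘ v) μ)
    (hμnn : ∀ i, 0 ≤ μ i) (hμ2 : ∃ i j, i ≠ j ∧ μ i ≠ 0 ∧ μ j ≠ 0) :
    IsCircuitRelation v μ := by
  classical
  obtain ⟨i, j, hij, hi, hj⟩ := hμ2
  have hdisj : ∀ k, c k ≠ 0 → μ k = 0 := by
    intro k hk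
    by_contra hμk
    obtain ⟨l, hl, hkl⟩ : ∃ l, μ l ≠ 0 ∧ k ≠ l := by
      by_cases h : k = i
      · exact ⟨j, hj, h ▸ hij⟩
      · exact ⟨i, hi, h⟩
    refine hμ.vector_ne_zero hkl hμk hl ?_
    simp only [Function.comp_apply, Submodule.mkQ_apply, Submodule.Quotient.mk_eq_zero]
    exact Submodule.subset_span ⟨k, hk, rfl⟩
  have hcμ : ∀ k, μ k ≠ 0 → c k = 0 := fun k hk => by
    by_contra h
    exact hk (hdisj k h)
  have hw : ∑ i, μ i • v i ∈ Submodule.span ℝ (v '' {i | c i ≠ 0}) := by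
    rw [← Submodule.Quotient.mk_eq_zero, ← Submodule.mkQ_apply, map_sum]
    simpa using hμ.sum_eq_zero
  obtain ⟨b, hbnn, hb, ⟨s, hs, hbs⟩, hsum⟩ := exists_nonneg_combination hc hnn hw
  have hcirc := hc.add_of_mkQ (b := -b) hμ hdisj (by simpa using hb) ⟨s, hs, by simpa using hbs⟩ (by
    simp [add_smul, Finset.sum_add_distrib, hsum])
  by_cases hb0 : b = 0
  · simpa [hb0] using hcirc
  exfalso
  -- The lift `μ - b` has two positive coefficients from `μ`, so at most one negative one: `b` lives
  -- on a single index.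
  have hneg : ∀ k l, 0 < b k → 0 < b l → k = l := by
    rcases hv _ hcirc with h | h
    · refine absurd (h i j ?_ ?_) hij
      · simpa [hb i (hcμ i hi)] using lt_of_le_of_ne (hμnn i) (Ne.symm hi)
      · simpa [hb j (hcμ j hj)] using lt_of_le_of_ne (hμnn j) (Ne.symm hj)
    · intro k l hk hl
      have hk' : μ k = 0 := hdisj k fun h => hk.ne' (hb k h)
      have hl' : μ l = 0 := hdisj l fun h => hl.ne' (hb l h)
      exact h k l (by simpa [hk'] using hk) (by simpa [hl'] using hl)
  obtain ⟨q, hq⟩ := Function.ne_iff.mp hb0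
  have hqpos : 0 < b q := lt_of_le_of_ne (hbnn q) (Ne.symm hq)
  have hcq : c q ≠ 0 := fun h => hq (hb q h)
  have hcqpos : 0 < c q := lt_of_le_of_ne (hnn q) (Ne.symm hcq)
  have hbne : ∀ k, k ≠ q → b k = 0 := fun k hk => by
    by_contra h
    exact hk (hneg k q (lt_of_le_of_ne (hbnn k) (Ne.symm h)) hqpos)
  -- Cancelling `b` at `q` with a multiple of `c` gives a nonnegative circuit. It loses only `q`
  -- from the support of `c` and gains at least `i` and `j`, against maximality.
  have hcirc' := hc.add_of_mkQ (b := (b q / c q) • c - b) hμ hdisj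
    (fun k hk => by simp [hk, hb k hk]) ⟨q, hcq, by simp [hcq]⟩ (by
      simp [add_smul, sub_smul, Finset.sum_add_distrib, Finset.sum_sub_distrib, hsum, mul_smul,
        ← Finset.smul_sum, hc.sum_eq_zero])
  have hle := hmax _ hcirc' (fun k => by
    by_cases hk : k = q
    · subst hk
      simp [hcq, hμnn]
    · simpa [hbne k hk] using
        add_nonneg (hμnn k) (mul_nonneg (div_nonneg hqpos.le hcqpos.le) (hnn k)))
  have hsub : insert i (insert j ({k | c k ≠ 0} \ {q})) ⊆
      {k | (μ + ((b q / c q) • c - b)) k ≠ 0} := by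
    rintro k (rfl | rfl | ⟨hk, hkq⟩)
    · simpa [hcμ k hi, hb k (hcμ k hi)] using hi
    · simpa [hcμ k hj, hb k (hcμ k hj)] using hj
    · simp only [Set.mem_ofPred_eq, Set.mem_singleton_iff] at hk hkq
      simp [hdisj k hk, hbne k hkq, hk, hqpos.ne', hcq]
  have h1 := Set.ncard_le_ncard hsub (Set.toFinite _)
  have h2 : (insert i (insert j ({k | c k ≠ 0} \ {q}))).ncard = {k | c k ≠ 0}.ncard + 1 := by
    rw [Set.ncard_insert_of_notMem (by simp [hij, hcμ i hi]) (Set.toFinite _),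
      Set.ncard_insert_of_notMem (by simp [hcμ j hj]) (Set.toFinite _),
      Set.ncard_sdiff_singleton_add_one (show q ∈ {k | c k ≠ 0} from hcq) (Set.toFinite _)]
  omega

/-- A positively spanning finite family all of whose circuits are one-sided contains positive
circuits whose spans decompose the whole space. -/
theorem exists_nonneg_circuit_decomposition {V : Type*} [AddCommGroup V] [Module ℝ V]
    [FiniteDimensional ℝ V] (v : ι → V) (hv : HasOneSidedCircuits v) (hp : PositivelySpans v) :
    ∃ (k : ℕ) (C : Fin k → ι → ℝ), (∀ a, IsCircuitRelation v (C a)) ∧ (∀ a i, 0 ≤ C a i) ∧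
      (∀ a, ∃ i j, i ≠ j ∧ C a i ≠ 0 ∧ C a j ≠ 0) ∧
      iSupIndep (fun a => Submodule.span ℝ (v '' {i | C a i ≠ 0})) ∧
      ⨆ a, Submodule.span ℝ (v '' {i | C a i ≠ 0}) = ⊤ := by
  classical
  induction hN : finrank ℝ V using Nat.strong_induction_on generalizing V with
  | _ N ih =>
  rcases subsingleton_or_nontrivial V with hV | hV
  · exact ⟨0, Fin.elim0, fun a => a.elim0, fun a => a.elim0, fun a => a.elim0,
      fun a => a.elim0, Subsingleton.elim _ _⟩
  obtain ⟨c₀, i₀, hc₀, hs₀, hpos₀, hne₀⟩ := hp.exists_nonneg_relation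
  obtain ⟨c₁, hc₁, hnn₁, hpos₁⟩ := exists_isCircuitRelation_of_nonneg v i₀ c₀ hc₀ hs₀ hpos₀
  obtain ⟨c, ⟨hc, hnn⟩, hmax⟩ : ∃ c, (IsCircuitRelation v c ∧ ∀ i, 0 ≤ c i) ∧
      ∀ c', IsCircuitRelation v c' → (∀ i, 0 ≤ c' i) →
        {i | c' i ≠ 0}.ncard ≤ {i | c i ≠ 0}.ncard := by
    have hfin : ((fun c : ι → ℝ => {i | c i ≠ 0}.ncard) ''
        {c | IsCircuitRelation v c ∧ ∀ i, 0 ≤ c i}).Finite :=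
      (Set.finite_Iic (Fintype.card ι)).subset (by
        rintro _ ⟨c, -, rfl⟩
        exact (Set.ncard_le_card _).trans (by simp))
    obtain ⟨c, hc, hmax⟩ := Set.exists_max_image _ id hfin ⟨_, c₁, ⟨hc₁, hnn₁⟩, rfl⟩
    obtain ⟨c, hc', rfl⟩ := hc
    exact ⟨c, hc', fun c' h h' => hmax _ ⟨c', ⟨h, h'⟩, rfl⟩⟩
  -- The circuit `c₁` involves the nonzero vector `v i₀`, so it needs a second term; `c` is at least
  -- as large.
  have hc2 : ∃ i j, i ≠ j ∧ c i ≠ 0 ∧ c j ≠ 0 := by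
    have h1 : 1 < {i | c₁ i ≠ 0}.ncard := by
      rw [Set.one_lt_ncard (Set.toFinite _)]
      by_contra! h
      have : ∀ i, i ≠ i₀ → c₁ i • v i = 0 := fun i hi => by
        by_contra hci
        exact hi (h i (fun h0 => hci (by simp [h0])) i₀ hpos₁.ne')
      have hsum := hc₁.sum_eq_zero
      rw [Finset.sum_eq_single i₀ (fun i _ hi => this i hi) (by simp)] at hsum
      rcases smul_eq_zero.mp hsum with h' | h'
      · exact hpos₁.ne' h'
      · exact hne₀ h'
    have h2 := h1.trans_le (hmax c₁ hc₁ hnn₁)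
    rw [Set.one_lt_ncard (Set.toFinite _)] at h2
    obtain ⟨i, hi, j, hj, hij⟩ := h2
    exact ⟨i, j, hij, hi, hj⟩
  set W := Submodule.span ℝ (v '' {i | c i ≠ 0}) with hW
  have hWbot : W ≠ ⊥ := by
    obtain ⟨i, j, hij, hi, hj⟩ := hc2
    intro h
    have : v i ∈ W := Submodule.subset_span ⟨i, hi, rfl⟩
    rw [h, Submodule.mem_bot] at this
    exact hc.vector_ne_zero hij hi hj this
  have hlt : finrank ℝ (V ⧸ W) < N := by
    have h1 := Submodule.finrank_quotient_add_finrank W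
    have h2 : 0 < finrank ℝ W := Nat.pos_of_ne_zero fun h => hWbot (Submodule.finrank_eq_zero.mp h)
    omega
  obtain ⟨k, C, hC, hCnn, hC2, hind, hsup⟩ := ih _ hlt (W.mkQ ∘ v) (hv.mkQ hc hnn) (hp.mkQ W) rfl
  have hC' : ∀ a, IsCircuitRelation v (C a) := fun a =>
    hc.of_mkQ hv hnn hmax (hC a) (hCnn a) (hC2 a)
  have hmap : ∀ a, (Submodule.span ℝ (v '' {i | C a i ≠ 0})).map W.mkQ =
      Submodule.span ℝ ((W.mkQ ∘ v) '' {i | C a i ≠ 0}) := fun a => by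
    rw [Submodule.map_span, Set.image_image]; rfl
  -- `C a` is a circuit both modulo `W` and in `V`: a combination vanishing modulo `W` is a multiple
  -- of `C a`, hence vanishes in `V`.
  have hinj : ∀ a, ∀ x ∈ Submodule.span ℝ (v '' {i | C a i ≠ 0}), W.mkQ x = 0 → x = 0 := by
    intro a x hx hx0
    obtain ⟨b, -, hb, -, rfl⟩ := exists_nonneg_combination (hC' a) (hCnn a) hx
    obtain ⟨t, rfl⟩ := (hC a).eq_smul b (by simpa [-Submodule.mkQ_apply] using hx0) hb
    simp [mul_smul, ← Finset.smul_sum, (hC' a).sum_eq_zero]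
  refine ⟨k + 1, Fin.cons c C, ?_, ?_, ?_, ?_, ?_⟩
  · exact Fin.cases hc hC'
  · exact Fin.cases hnn hCnn
  · exact Fin.cases hc2 hC2
  · refine iSupIndep_of_sum_eq_zero fun x hx hsum => ?_
    have hind' := (iSupIndep_iff_finsetSum_eq_zero_imp_eq_zero _).mp hind Finset.univ
      (fun a => W.mkQ (x a.succ)) (fun a _ => by
        rw [← hmap a]
        exact Submodule.mem_map_of_mem (hx a.succ)) (by
        have h0 : W.mkQ (x 0) = 0 := (Submodule.Quotient.mk_eq_zero W).mpr (hx 0)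
        have := congrArg W.mkQ hsum
        rwa [Fin.sum_univ_succ, map_add, h0, zero_add, map_sum, map_zero] at this)
    have hsucc : ∀ a : Fin k, x a.succ = 0 := fun a =>
      hinj a _ (hx a.succ) (hind' a (Finset.mem_univ a))
    rw [Fin.sum_univ_succ] at hsum
    exact Fin.cases (by simpa [hsucc] using hsum) hsucc
  · rw [eq_top_iff]
    intro x _
    have hx : W.mkQ x ∈ (⨆ a, Submodule.span ℝ (v '' {i | C a i ≠ 0})).map W.mkQ := by
      rw [Submodule.map_iSup]
      simp only [hmap, hsup, Submodule.mem_top]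
    obtain ⟨y, hy, hyx⟩ := hx
    have hxy : x - y ∈ W := by
      rw [← Submodule.Quotient.mk_eq_zero, ← Submodule.mkQ_apply, map_sub, hyx, sub_self]
    rw [← sub_add_cancel x y]
    refine add_mem (Submodule.mem_iSup_of_mem 0 hxy) (?_ : y ∈ _)
    refine (iSup_le fun a => ?_ : (⨆ a, Submodule.span ℝ (v '' {i | C a i ≠ 0})) ≤ _) hy
    exact le_iSup (fun b : Fin (k + 1) => Submodule.span ℝ
      (v '' {i | (Fin.cons c C : Fin (k + 1) → ι → ℝ) b i ≠ 0})) a.succ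

end Decomposition

/-! ### Nonnegative circuits as simplices around the origin -/

section Simplices

variable {ι : Type*} [Fintype ι]

/-- An affine dependence is a multiple of `c` with coefficient sum zero, whereas the coefficients of
`c` have positive sum. -/
lemma IsCircuitRelation.affineIndependent {V : Type*} [AddCommGroup V] [Module ℝ V] {v : ι → V}
    {c : ι → ℝ} (hc : IsCircuitRelation v c) (hnn : ∀ i, 0 ≤ c i) :
    AffineIndependent ℝ ((↑) : (v '' {i | c i ≠ 0} : Set V) → V) := by
  classical
  have h : AffineIndependent ℝ (fun i : {i | c i ≠ 0} => v i) := by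
    rw [affineIndependent_iff]
    intro s w hw hws
    let w' : ι → ℝ := fun i => if h : c i ≠ 0 then (if ⟨i, h⟩ ∈ s then w ⟨i, h⟩ else 0) else 0
    have hw' : ∀ j : {i | c i ≠ 0}, j ∈ s → w' j = w j := fun j hj => by
      have : c j ≠ 0 := j.2
      simp [w', this, hj]
    have hw0 : ∀ i, i ∉ s.map (Function.Embedding.subtype _) → w' i = 0 := by
      intro i hi
      by_cases h : c i ≠ 0
      · have : (⟨i, h⟩ : {i | c i ≠ 0}) ∉ s := fun hs => hi (Finset.mem_map.mpr ⟨⟨i, h⟩, hs, rfl⟩)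
        simp [w', this]
      · simp [w', h]
    have hsum : ∑ i, w' i = 0 := by
      rw [← hw, ← Finset.sum_subset (Finset.subset_univ (s.map (Function.Embedding.subtype _)))
        fun i _ hi => hw0 i hi, Finset.sum_map]
      exact Finset.sum_congr rfl fun j hj => hw' j hj
    have hsumv : ∑ i, w' i • v i = 0 := by
      rw [← hws, ← Finset.sum_subset (Finset.subset_univ (s.map (Function.Embedding.subtype _)))
        fun i _ hi => by rw [hw0 i hi, zero_smul], Finset.sum_map]
      exact Finset.sum_congr rfl fun j hj => by
        simp only [Function.Embedding.subtype_apply, hw' j hj]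
    obtain ⟨t, ht⟩ := hc.eq_smul w' hsumv fun i hi => by simp [w', hi]
    have hcpos : 0 < ∑ i, c i := by
      obtain ⟨j, hj⟩ := Function.ne_iff.mp hc.ne_zero
      exact Finset.sum_pos' (fun i _ => hnn i) ⟨j, Finset.mem_univ j, lt_of_le_of_ne (hnn j) (Ne.symm hj)⟩
    have ht0 : t = 0 := by
      simp only [ht, Pi.smul_apply, smul_eq_mul, ← Finset.mul_sum] at hsum
      exact (mul_eq_zero.mp hsum).resolve_right hcpos.ne'
    intro j hj
    rw [← hw' j hj, ht, ht0, zero_smul, Pi.zero_apply]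
  rw [Set.image_eq_range]
  exact h.range

/-- A combination of finitely many vectors with positive weights vanishing implies that `0` is a
relative interior point of their convex hull. -/
lemma zero_mem_intrinsicInterior_convexHull_range {V : Type*} [NormedAddCommGroup V]
    [NormedSpace ℝ V] [FiniteDimensional ℝ V] (v : ι → V) {c : ι → ℝ} (hpos : ∀ i, 0 < c i)
    (hsum : ∑ i, c i • v i = 0) (hc : ∑ i, c i = 1) :
    (0 : V) ∈ intrinsicInterior ℝ (convexHull ℝ (Set.range v)) := by
  classical
  set W := Submodule.span ℝ (Set.range v) with hW
  let T : (ι → ℝ) →ₗ[ℝ] W :=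
    (Fintype.linearCombination ℝ v).codRestrict W fun a => by
      rw [Fintype.linearCombination_apply]
      exact Submodule.sum_mem _ fun i _ => Submodule.smul_mem _ _ (Submodule.subset_span ⟨i, rfl⟩)
  have hTapp : ∀ a, (T a : V) = ∑ i, a i • v i := fun a => by
    simp [T, Fintype.linearCombination_apply]
  have hT : Function.Surjective T := by
    rintro ⟨w, hw⟩
    rw [hW, ← Fintype.range_linearCombination] at hw
    obtain ⟨a, ha⟩ := hw
    exact ⟨a, Subtype.ext (by simpa [T] using ha)⟩
  -- The added multiple of `c` brings the total weight to `1` without changing the combination. `T`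
  -- is open, so `T '' U` is a neighbourhood of `0` in `W`.
  let U : Set (ι → ℝ) := {a | ∀ i, 0 < a i + (1 - ∑ j, a j) * c i}
  have hU : IsOpen U := by
    simp only [U, Set.ofPred_forall]
    exact isOpen_iInter_of_finite fun i => isOpen_lt (by fun_prop) (by fun_prop)
  have hTU : IsOpen (T '' U) := T.isOpenMap_of_finiteDimensional hT U hU
  obtain ⟨O, hO, hOU⟩ := isOpen_induced_iff.mp hTU
  have hmem : ∀ a ∈ U, (T a : V) ∈ convexHull ℝ (Set.range v) := by
    intro a ha
    have : (T a : V) = ∑ i, (a i + (1 - ∑ j, a j) * c i) • v i := by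
      simp [hTapp, add_smul, Finset.sum_add_distrib, mul_smul, ← Finset.smul_sum, hsum]
    rw [this]
    refine (convex_convexHull ℝ _).sum_mem (fun i _ => (ha i).le) ?_
      fun i _ => subset_convexHull _ _ ⟨i, rfl⟩
    simp [Finset.sum_add_distrib, ← Finset.mul_sum, hc]
  have h0U : (0 : ι → ℝ) ∈ U := by simpa [U] using hpos
  have h0 : (0 : V) ∈ affineSpan ℝ (convexHull ℝ (Set.range v)) := by
    have := hmem 0 h0U
    rw [map_zero] at this
    exact subset_affineSpan _ _ this
  have hsub : ∀ x ∈ affineSpan ℝ (convexHull ℝ (Set.range v)), x ∈ W := by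
    intro x hx
    rw [affineSpan_convexHull] at hx
    exact affineSpan_subset_span hx
  rw [mem_intrinsicInterior]
  refine ⟨⟨0, h0⟩, ?_, rfl⟩
  rw [mem_interior]
  refine ⟨(↑) ⁻¹' O, ?_, hO.preimage continuous_subtype_val, ?_⟩
  · rintro ⟨x, hx⟩ hxO
    have : (⟨x, hsub x hx⟩ : W) ∈ T '' U := hOU ▸ hxO
    obtain ⟨a, ha, hax⟩ := this
    have := hmem a ha
    rwa [hax] at this
  · have : (0 : W) ∈ T '' U := ⟨0, h0U, map_zero _⟩
    rw [← hOU] at this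
    exact this

lemma sum_subtype_ne_zero {M : Type*} [AddCommMonoid M] (c : ι → ℝ) [Fintype {i | c i ≠ 0}]
    (f : ι → M) (hf : ∀ i, c i = 0 → f i = 0) : ∑ i : {i | c i ≠ 0}, f i = ∑ i, f i := by
  classical
  rw [← Finset.sum_subset (Finset.subset_univ (Finset.univ.filter fun i => c i ≠ 0))
    fun i _ hi => hf i (by simpa using hi)]
  exact (Finset.sum_subtype _ (by simp) f).symm

lemma IsCircuitRelation.zero_mem_intrinsicInterior {V : Type*} [NormedAddCommGroup V]
    [NormedSpace ℝ V] [FiniteDimensional ℝ V] {v : ι → V}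
    {c : ι → ℝ} (hc : IsCircuitRelation v c) (hnn : ∀ i, 0 ≤ c i) :
    (0 : V) ∈ intrinsicInterior ℝ (convexHull ℝ (v '' {i | c i ≠ 0})) := by
  classical
  have hcpos : 0 < ∑ i, c i := by
    obtain ⟨j, hj⟩ := Function.ne_iff.mp hc.ne_zero
    exact Finset.sum_pos' (fun i _ => hnn i) ⟨j, Finset.mem_univ j, lt_of_le_of_ne (hnn j) (Ne.symm hj)⟩
  rw [Set.image_eq_range]
  refine zero_mem_intrinsicInterior_convexHull_range (c := fun i => c i / ∑ j, c j) _
    (fun i => div_pos (lt_of_le_of_ne (hnn i) (Ne.symm i.2)) hcpos) ?_ ?_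
  · rw [sum_subtype_ne_zero c (fun i => (c i / ∑ j, c j) • v i) (fun i hi => by simp [hi])]
    simp [div_eq_inv_mul, mul_smul, ← Finset.smul_sum, hc.sum_eq_zero]
  · rw [sum_subtype_ne_zero c (fun i => c i / ∑ j, c j) (fun i hi => by simp [hi]), ← Finset.sum_div,
      div_self hcpos.ne']

end Simplices

/-! ### Polyhedra given by inequalities -/

section Halfspaces

variable {E : Type*} [NormedAddCommGroup E] [InnerProductSpace ℝ E]

/-- The intersection of the halfspaces `⟨v i, x⟩ ≤ h i`. -/
def halfspaceInter {ι : Type*} (v : ι → E) (h : ι → ℝ) : Set E :=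
  {x | ∀ i, inner ℝ (v i) x ≤ h i}

lemma isClosed_halfspaceInter {ι : Type*} (v : ι → E) (h : ι → ℝ) :
    IsClosed (halfspaceInter v h) := by
  simp only [halfspaceInter, Set.ofPred_forall]
  exact isClosed_iInter fun i => isClosed_le (by fun_prop) (by fun_prop)

lemma convex_halfspaceInter {ι : Type*} (v : ι → E) (h : ι → ℝ) :
    Convex ℝ (halfspaceInter v h) := by
  intro x hx y hy a b ha hb hab i
  rw [inner_add_right, inner_smul_right, inner_smul_right]
  calc a * inner ℝ (v i) x + b * inner ℝ (v i) y ≤ a * h i + b * h i :=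
        add_le_add (mul_le_mul_of_nonneg_left (hx i) ha) (mul_le_mul_of_nonneg_left (hy i) hb)
    _ = h i := by rw [← add_mul, hab, one_mul]

lemma eq_zero_of_inner_eq_zero {s : Set E} (hs : Submodule.span ℝ s = ⊤) {x : E}
    (h : ∀ u ∈ s, inner ℝ u x = 0) : x = 0 := by
  have : x ∈ (Submodule.span ℝ s)ᗮ := by
    rw [Submodule.mem_orthogonal]
    intro u hu
    induction hu using Submodule.span_induction with
    | mem u hu => exact h u hu
    | zero => simp
    | add u w _ _ hu hw => rw [inner_add_left, hu, hw, add_zero]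
    | smul a u _ hu => rw [inner_smul_left, hu, mul_zero]
  simpa [hs] using this

lemma exists_ne_zero_inner_eq_zero [FiniteDimensional ℝ E] {s : Set E}
    (hs : Submodule.span ℝ s ≠ ⊤) : ∃ d : E, d ≠ 0 ∧ ∀ u ∈ s, inner ℝ u d = 0 := by
  have : (Submodule.span ℝ s)ᗮ ≠ ⊥ := fun h => hs (Submodule.orthogonal_eq_bot_iff.mp h)
  obtain ⟨d, hd, hd0⟩ := Submodule.exists_mem_ne_zero_of_ne_bot this
  exact ⟨d, hd0, fun u hu => (Submodule.mem_orthogonal _ _).mp hd u (Submodule.subset_span hu)⟩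

lemma eventually_inner_add_smul_lt {u x d : E} {r : ℝ} (h : inner ℝ u x < r) :
    ∀ᶠ δ : ℝ in nhds 0, inner ℝ u (x + δ • d) < r := by
  have : Filter.Tendsto (fun δ : ℝ => inner ℝ u (x + δ • d)) (nhds 0) (nhds (inner ℝ u x)) := by
    have hc : Continuous fun δ : ℝ => inner ℝ u (x + δ • d) := by fun_prop
    simpa using hc.tendsto 0
  exact this.eventually_lt_const h

/-- A small perturbation of a point of a polyhedron, orthogonal to the tight constraints, stays in
the polyhedron. -/
lemma exists_pos_add_smul_mem {ι : Type*} [Finite ι] {v : ι → E} {h : ι → ℝ} {x d : E}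
    (hx : x ∈ halfspaceInter v h) (hd : ∀ i, inner ℝ (v i) x = h i → inner ℝ (v i) d = 0) :
    ∃ δ : ℝ, 0 < δ ∧ x + δ • d ∈ halfspaceInter v h := by
  have h1 : ∀ᶠ δ : ℝ in nhds 0, x + δ • d ∈ halfspaceInter v h := by
    rw [show (∀ᶠ δ : ℝ in nhds 0, x + δ • d ∈ halfspaceInter v h) ↔
      ∀ᶠ δ : ℝ in nhds 0, ∀ i, inner ℝ (v i) (x + δ • d) ≤ h i from Iff.rfl]
    rw [Filter.eventually_all]
    intro i
    rcases (hx i).lt_or_eq with hlt | heq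
    · exact (eventually_inner_add_smul_lt hlt).mono fun _ => le_of_lt
    · exact Filter.Eventually.of_forall fun δ => by
        rw [inner_add_right, inner_smul_right, hd i heq, heq]; simp
  obtain ⟨δ, hδ, hδ'⟩ := ((h1.filter_mono nhdsWithin_le_nhds).and
    (self_mem_nhdsWithin : Set.Ioi (0 : ℝ) ∈ nhdsWithin 0 (Set.Ioi 0))).exists
  exact ⟨δ, hδ', hδ⟩

/-- Otherwise the point could move both ways along a direction orthogonal to the tight normals. -/
lemma span_tight_eq_top_of_mem_extremePoints [FiniteDimensional ℝ E] {ι : Type*} [Finite ι]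
    {v : ι → E} {h : ι → ℝ} {x : E} (hx : x ∈ (halfspaceInter v h).extremePoints ℝ) :
    Submodule.span ℝ (v '' {i | inner ℝ (v i) x = h i}) = ⊤ := by
  by_contra hne
  obtain ⟨d, hd0, hd⟩ := exists_ne_zero_inner_eq_zero hne
  have hd' : ∀ i, inner ℝ (v i) x = h i → inner ℝ (v i) d = 0 := fun i hi => hd _ ⟨i, hi, rfl⟩
  obtain ⟨δ, hδ, h1⟩ := exists_pos_add_smul_mem hx.1 hd'
  obtain ⟨ε, hε, h2⟩ := exists_pos_add_smul_mem (d := -d) hx.1 fun i hi => by simp [hd' i hi]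
  have := hx.2 h1 h2 ⟨ε / (δ + ε), δ / (δ + ε), by positivity, by positivity, by field_simp; ring, by
    rw [smul_add, smul_add, smul_neg, add_add_add_comm, ← add_smul, ← add_div, add_comm ε δ,
      div_self (by positivity), one_smul, smul_neg, smul_smul, smul_smul, ← sub_eq_add_neg,
      ← sub_smul, show ε / (δ + ε) * δ - δ / (δ + ε) * ε = 0 by ring, zero_smul, add_zero]⟩
  simp [hδ.ne', hd0] at this

/-- The function `∑ max(0, ⟨v i, ·⟩)` has a positive minimum on the unit sphere and is positively
homogeneous; on the polyhedron it is at most `∑ |h i|`. -/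
lemma isBounded_halfspaceInter [FiniteDimensional ℝ E] {ι : Type*} [Fintype ι] {v : ι → E}
    (hv : ∀ a : E, (∀ i, inner ℝ (v i) a ≤ 0) → a = 0) (h : ι → ℝ) :
    Bornology.IsBounded (halfspaceInter v h) := by
  rcases subsingleton_or_nontrivial E with hE | hE
  · exact Bornology.IsBounded.subset (Bornology.isBounded_singleton (x := (0 : E)))
      fun x _ => Subsingleton.elim x 0
  let g : E → ℝ := fun a => ∑ i, max 0 (inner ℝ (v i) a)
  have hg : Continuous g := by
    refine continuous_finsetSum _ fun i _ => ?_
    fun_prop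
  obtain ⟨a, ha, hmin⟩ := (isCompact_sphere (0 : E) 1).exists_isMinOn
    (NormedSpace.sphere_nonempty.mpr zero_le_one) hg.continuousOn
  have hga : 0 < g a := by
    refine lt_of_le_of_ne (Finset.sum_nonneg fun i _ => le_max_left _ _) fun h0 => ?_
    have : a = 0 := hv a fun i => by
      have := (Finset.sum_eq_zero_iff_of_nonneg fun i _ => le_max_left 0 _).mp h0.symm i
        (Finset.mem_univ i)
      exact max_eq_left_iff.mp this
    simp [this] at ha
  refine (Metric.isBounded_closedBall (x := (0 : E)) (r := (∑ i, |h i|) / g a)).subset fun x hx => ?_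
  rw [mem_closedBall_zero_iff, le_div_iff₀ hga]
  by_cases hx0 : x = 0
  · simp [hx0]
    exact Finset.sum_nonneg fun i _ => abs_nonneg _
  have hnx : 0 < ‖x‖ := norm_pos_iff.mpr hx0
  have h1 : g a ≤ g (‖x‖⁻¹ • x) := hmin (by simp [norm_smul, hnx.ne'])
  have h2 : g (‖x‖⁻¹ • x) = ‖x‖⁻¹ * g x := by
    simp only [g, Finset.mul_sum, inner_smul_right]
    exact Finset.sum_congr rfl fun i _ => by
      rw [mul_max_of_nonneg _ _ (inv_nonneg.mpr hnx.le), mul_zero]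
  have h3 : g x ≤ ∑ i, |h i| := Finset.sum_le_sum fun i _ =>
    max_le (abs_nonneg _) ((hx i).trans (le_abs_self _))
  calc ‖x‖ * g a ≤ ‖x‖ * (‖x‖⁻¹ * g x) := mul_le_mul_of_nonneg_left (h1.trans_eq h2) hnx.le
    _ = g x := by field_simp
    _ ≤ _ := h3

lemma isCompact_halfspaceInter [FiniteDimensional ℝ E] {ι : Type*} [Fintype ι] {v : ι → E}
    (hv : ∀ a : E, (∀ i, inner ℝ (v i) a ≤ 0) → a = 0) (h : ι → ℝ) :
    IsCompact (halfspaceInter v h) :=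
  Metric.isCompact_of_isClosed_isBounded (isClosed_halfspaceInter v h)
    (isBounded_halfspaceInter hv h)

lemma eq_of_span_tight_eq_top {ι : Type*} {v : ι → E} {h : ι → ℝ} {T : Set ι} {x y : E}
    (hT : Submodule.span ℝ (v '' T) = ⊤) (hx : ∀ i ∈ T, inner ℝ (v i) x = h i)
    (hy : ∀ i ∈ T, inner ℝ (v i) y = h i) : x = y := by
  refine sub_eq_zero.mp (eq_zero_of_inner_eq_zero hT ?_)
  rintro _ ⟨i, hi, rfl⟩
  rw [inner_sub_right, hx i hi, hy i hi, sub_self]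

lemma finite_span_tight_eq_top {ι : Type*} [Finite ι] (v : ι → E) (h : ι → ℝ) :
    {x | Submodule.span ℝ (v '' {i | inner ℝ (v i) x = h i}) = ⊤}.Finite := by
  refine Set.Finite.of_injOn (f := fun x => {i | inner ℝ (v i) x = h i}) (t := Set.univ)
    (fun _ _ => Set.mem_univ _) (fun x hx y hy hxy => ?_) Set.finite_univ
  refine eq_of_span_tight_eq_top hx (fun i hi => hi) fun i hi => ?_
  exact hxy.subset hi

lemma exists_finite_halfspaceInter_eq_convexHull [FiniteDimensional ℝ E] {ι : Type*} [Fintype ι]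
    {v : ι → E} (hv : ∀ a : E, (∀ i, inner ℝ (v i) a ≤ 0) → a = 0) (h : ι → ℝ) :
    ∃ V : Set E, V.Finite ∧ halfspaceInter v h = convexHull ℝ V := by
  have hfin : ((halfspaceInter v h).extremePoints ℝ).Finite :=
    (finite_span_tight_eq_top v h).subset fun x hx => span_tight_eq_top_of_mem_extremePoints hx
  refine ⟨_, hfin, ?_⟩
  rw [← (hfin.isClosed_convexHull ℝ).closure_eq]
  exact (closure_convexHull_extremePoints (isCompact_halfspaceInter hv h)
    (convex_halfspaceInter v h)).symm

end Halfspaces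

/-! ### Facets determine their normals up to sign -/

section Hyperplanes

variable {E : Type*} [NormedAddCommGroup E] [InnerProductSpace ℝ E]

lemma vectorSpan_le_orthogonal {F : Set E} {u : E} {r : ℝ} (hF : ∀ x ∈ F, inner ℝ u x = r) :
    vectorSpan ℝ F ≤ (Submodule.span ℝ {u})ᗮ := by
  rw [vectorSpan_def, Submodule.span_le]
  rintro _ ⟨x, hx, y, hy, rfl⟩
  rw [SetLike.mem_coe, Submodule.mem_orthogonal_singleton_iff_inner_right]
  simp only [vsub_eq_sub]
  rw [inner_sub_right, hF x hx, hF y hy, sub_self]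

lemma finrank_orthogonal_span_singleton_add_one [FiniteDimensional ℝ E] {u : E} (hu : u ≠ 0) :
    finrank ℝ (Submodule.span ℝ {u})ᗮ + 1 = finrank ℝ E := by
  have := Submodule.finrank_add_finrank_orthogonal (Submodule.span ℝ {u})
  rw [finrank_span_singleton hu] at this
  omega

lemma vectorSpan_eq_orthogonal [FiniteDimensional ℝ E] {F : Set E} {u : E} {r : ℝ} (hu : u ≠ 0)
    (hF : ∀ x ∈ F, inner ℝ u x = r) (hdim : finrank ℝ (vectorSpan ℝ F) + 1 = finrank ℝ E) :
    vectorSpan ℝ F = (Submodule.span ℝ {u})ᗮ := by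
  refine Submodule.eq_of_le_of_finrank_eq (vectorSpan_le_orthogonal hF) ?_
  have := finrank_orthogonal_span_singleton_add_one hu
  omega

lemma eq_or_eq_neg_of_orthogonal_eq [FiniteDimensional ℝ E] {u w : E} (hu : ‖u‖ = 1)
    (hw : ‖w‖ = 1) (h : (Submodule.span ℝ {u})ᗮ = (Submodule.span ℝ {w})ᗮ) : w = u ∨ w = -u := by
  have h' : Submodule.span ℝ {u} = Submodule.span ℝ {w} := by
    rw [← Submodule.orthogonal_orthogonal (Submodule.span ℝ {u}), h,
      Submodule.orthogonal_orthogonal]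
  have : w ∈ Submodule.span ℝ {u} := h' ▸ Submodule.mem_span_singleton_self w
  obtain ⟨t, rfl⟩ := Submodule.mem_span_singleton.mp this
  rw [norm_smul, hu, mul_one, Real.norm_eq_abs] at hw
  rcases eq_or_eq_neg_of_abs_eq hw with rfl | rfl
  · exact Or.inl (one_smul _ _)
  · exact Or.inr (by simp)

lemma exists_inner_ne_of_interior_nonempty {Q : Set E} (hQ : (interior Q).Nonempty) {u : E}
    (hu : u ≠ 0) (r : ℝ) : ∃ x ∈ Q, inner ℝ u x ≠ r := by
  obtain ⟨x, hx⟩ := hQ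
  by_contra! hcon
  have hc : Continuous fun δ : ℝ => x + δ • u := by fun_prop
  have h1 : ∀ᶠ δ : ℝ in nhds 0, x + δ • u ∈ Q :=
    hc.continuousAt.eventually_mem (by simpa using mem_interior_iff_mem_nhds.mp hx)
  obtain ⟨δ, hδ, hδ'⟩ := ((h1.filter_mono nhdsWithin_le_nhds).and
    (self_mem_nhdsWithin : Set.Ioi (0 : ℝ) ∈ nhdsWithin 0 (Set.Ioi 0))).exists
  have h2 := hcon _ hδ
  rw [inner_add_right, hcon x (interior_subset hx), inner_smul_right, add_eq_left] at h2
  exact (mul_pos hδ' (real_inner_self_pos.mpr hu)).ne' h2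

end Hyperplanes

/-! ### Irredundant right hand sides -/

section Irredundant

variable {E : Type*} [NormedAddCommGroup E] [InnerProductSpace ℝ E]

/-- Each inequality `⟨v i, x⟩ ≤ h i` is tight at a point where all the others are strict. -/
def IsIrredundant {ι : Type*} (v : ι → E) (h : ι → ℝ) : Prop :=
  ∀ i, ∃ p : E, inner ℝ (v i) p = h i ∧ ∀ j, j ≠ i → inner ℝ (v j) p < h j

lemma IsIrredundant.exists_forall_lt {ι : Type*} [Finite ι] [Nonempty ι] {v : ι → E} {h : ι → ℝ}
    (hv : ∀ i, v i ≠ 0) (hh : IsIrredundant v h) : ∃ x : E, ∀ i, inner ℝ (v i) x < h i := by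
  obtain ⟨i⟩ := ‹Nonempty ι›
  obtain ⟨p, hp, hlt⟩ := hh i
  have h1 : ∀ᶠ δ : ℝ in nhds 0, ∀ j, j ≠ i → inner ℝ (v j) (p + δ • -v i) < h j := by
    simp only [Filter.eventually_all]
    exact fun j hj => eventually_inner_add_smul_lt (hlt j hj)
  obtain ⟨δ, hδ, hδ'⟩ := ((h1.filter_mono nhdsWithin_le_nhds).and
    (self_mem_nhdsWithin : Set.Ioi (0 : ℝ) ∈ nhdsWithin 0 (Set.Ioi 0))).exists
  refine ⟨p + δ • -v i, fun j => ?_⟩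
  by_cases hj : j = i
  · subst hj
    have : 0 < δ * inner ℝ (v j) (v j) := mul_pos hδ' (real_inner_self_pos.mpr (hv j))
    rw [inner_add_right, inner_smul_right, inner_neg_right, hp]
    linarith
  · exact hδ j hj

lemma mem_interior_halfspaceInter {ι : Type*} [Finite ι] {v : ι → E} {h : ι → ℝ} {x : E}
    (hx : ∀ i, inner ℝ (v i) x < h i) : x ∈ interior (halfspaceInter v h) := by
  rw [mem_interior]
  refine ⟨{x | ∀ i, inner ℝ (v i) x < h i}, fun y hy i => (hy i).le, ?_, hx⟩
  simp only [Set.ofPred_forall]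
  exact isOpen_iInter_of_finite fun i => isOpen_lt (by fun_prop) (by fun_prop)

/-- Irredundancy of unit normals survives small perturbations of the right hand sides. -/
lemma IsIrredundant.eventually_add_smul {ι : Type*} [Finite ι] {v : ι → E} {h : ι → ℝ}
    (hv : ∀ i, ‖v i‖ = 1) (hh : IsIrredundant v h) (g : ι → ℝ) :
    ∀ᶠ δ : ℝ in nhds 0, IsIrredundant v (h + δ • g) := by
  refine Filter.eventually_all.mpr fun i => ?_
  obtain ⟨p, hp, hlt⟩ := hh i
  have h1 : ∀ᶠ δ : ℝ in nhds 0, ∀ j, j ≠ i →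
      inner ℝ (v j) (p + (δ * g i) • v i) < (h + δ • g) j := by
    simp only [Filter.eventually_all]
    intro j hj
    have hc1 : Continuous fun δ : ℝ => inner ℝ (v j) (p + (δ * g i) • v i) := by fun_prop
    have hc2 : Continuous fun δ : ℝ => (h + δ • g) j := by
      simp only [Pi.add_apply, Pi.smul_apply]; fun_prop
    exact hc1.continuousAt.eventually_lt hc2.continuousAt (by simpa using hlt j hj)
  filter_upwards [h1] with δ hδ
  refine ⟨_, ?_, hδ⟩
  rw [inner_add_right, inner_smul_right, hp, real_inner_self_eq_norm_sq, hv i]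
  simp

/-- Support numbers of the form `1 + Σ tₐ max(0, ⟨a, u⟩)` are irredundant. -/
lemma isIrredundant_one_add_max {ι : Type*} {v : ι → E} (hv : ∀ i, ‖v i‖ = 1)
    (hinj : Function.Injective v) {s t : ℝ} (hs : 0 ≤ s) (ht : 0 ≤ t) (a b : E) :
    IsIrredundant v fun i => 1 + s * max 0 (inner ℝ (v i) a) + t * max 0 (inner ℝ (v i) b) := by
  classical
  -- `max(0, ⟨·, a⟩)` is the support function of the segment from `0` to `a`. The right hand sides
  -- are thus support numbers of the unit ball plus two segments, and the ball makes the other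
  -- inequalities strict.
  have key : ∀ (a u : E), ∃ q : E, inner ℝ u q = max 0 (inner ℝ u a) ∧
      ∀ w : E, inner ℝ w q ≤ max 0 (inner ℝ w a) := by
    intro a u
    rcases le_total 0 (inner ℝ u a) with h | h
    · exact ⟨a, (max_eq_right h).symm, fun w => le_max_right _ _⟩
    · exact ⟨0, by rw [inner_zero_right, max_eq_left h], fun w => by simp⟩
  intro i
  obtain ⟨q, hq, hqle⟩ := key a (v i)
  obtain ⟨r, hr, hrle⟩ := key b (v i)
  refine ⟨v i + s • q + t • r, ?_, fun j hj => ?_⟩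
  · simp [inner_add_right, inner_smul_right, hq, hr, hv i]
  · have h1 : inner ℝ (v j) (v i) < 1 :=
      (inner_lt_one_iff_real_of_norm_eq_one (hv j) (hv i)).mpr fun h => hj (hinj h)
    have h2 := mul_le_mul_of_nonneg_left (hqle (v j)) hs
    have h3 := mul_le_mul_of_nonneg_left (hrle (v j)) ht
    rw [inner_add_right, inner_add_right, inner_smul_right, inner_smul_right]
    linarith

end Irredundant

/-! ### Normals of polytopes -/

namespace StrongMonotypy

variable {n : ℕ}

lemma support_eq {P : Set (EuclideanSpace ℝ (Fin n))} {u : EuclideanSpace ℝ (Fin n)} {r : ℝ}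
    (hle : ∀ x ∈ P, inner ℝ u x ≤ r) (hex : ∃ x ∈ P, inner ℝ u x = r) : support P u = r := by
  refine IsGreatest.csSup_eq ⟨?_, ?_⟩
  · obtain ⟨x, hx, rfl⟩ := hex
    exact ⟨x, hx, rfl⟩
  · rintro _ ⟨x, hx, rfl⟩
    exact hle x hx

lemma IsPolytope.isCompact {P : Set (EuclideanSpace ℝ (Fin n))} (hP : IsPolytope P) :
    IsCompact P := by
  obtain ⟨⟨V, hV, rfl⟩, -⟩ := hP
  exact hV.isCompact_convexHull ℝ

lemma IsPolytope.convex {P : Set (EuclideanSpace ℝ (Fin n))} (hP : IsPolytope P) :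
    Convex ℝ P := by
  obtain ⟨⟨V, hV, rfl⟩, -⟩ := hP
  exact convex_convexHull ℝ V

lemma IsPolytope.inner_le_support {P : Set (EuclideanSpace ℝ (Fin n))} (hP : IsPolytope P)
    (u : EuclideanSpace ℝ (Fin n)) {x : EuclideanSpace ℝ (Fin n)} (hx : x ∈ P) :
    inner ℝ u x ≤ support P u :=
  le_csSup (hP.isCompact.bddAbove_image (by fun_prop)) ⟨x, hx, rfl⟩

lemma IsPolytope.isExposed_inter_supportHyperplane {P : Set (EuclideanSpace ℝ (Fin n))}
    (hP : IsPolytope P) (u : EuclideanSpace ℝ (Fin n)) :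
    IsExposed ℝ P (P ∩ supportHyperplane P u) := by
  rintro ⟨x, hx, hxu⟩
  refine ⟨innerSL ℝ u, Set.ext fun y => ⟨fun hy => ⟨hy.1, fun z hz => ?_⟩, fun hy => ⟨hy.1, ?_⟩⟩⟩
  · exact (hP.inner_le_support u hz).trans_eq hy.2.symm
  · exact le_antisymm (hP.inner_le_support u hy.1) (hxu.symm.trans_le (hy.2 x hx))

/-- The face in direction of a normal determines the normal. -/
lemma IsPolytope.injOn_normals {P : Set (EuclideanSpace ℝ (Fin n))} (hP : IsPolytope P) :
    Set.InjOn (fun u => P ∩ supportHyperplane P u) (normals P) := by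
  rintro u ⟨hu, ⟨x, hx, hxu⟩, hdu⟩ w ⟨hw, -, hdw⟩ huw
  simp only at huw
  have hu0 : u ≠ 0 := fun h => by simp [h] at hu
  have hw0 : w ≠ 0 := fun h => by simp [h] at hw
  have h1 := vectorSpan_eq_orthogonal (F := P ∩ supportHyperplane P u) hu0 (fun x hx => hx.2)
    (by rw [hdu, finrank_euclideanSpace_fin])
  have h2 := vectorSpan_eq_orthogonal (F := P ∩ supportHyperplane P w) hw0 (fun x hx => hx.2)
    (by rw [hdw, finrank_euclideanSpace_fin])
  rcases eq_or_eq_neg_of_orthogonal_eq hu hw (h1.symm.trans ((congrArg _ huw).trans h2)) with h | h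
  · exact h.symm
  -- With opposite normals, `P` would be squeezed into one hyperplane.
  · exfalso
    subst h
    have hxw : x ∈ P ∩ supportHyperplane P (-u) := huw ▸ ⟨hx, hxu⟩
    obtain ⟨y, hy, hne⟩ := exists_inner_ne_of_interior_nonempty hP.2 hu0 (support P u)
    have h3 := hP.inner_le_support u hy
    have h4 := hP.inner_le_support (-u) hy
    have h5 : inner ℝ u x = support P u := hxu
    have h6 : inner ℝ (-u) x = support P (-u) := hxw.2
    rw [inner_neg_left] at h4 h6
    exact hne (by linarith)

/-- A normal is determined by its facet, and the facet by its extreme points, which are among the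
finitely many generators of `P`. -/
lemma IsPolytope.finite_normals {P : Set (EuclideanSpace ℝ (Fin n))} (hP : IsPolytope P) :
    (normals P).Finite := by
  obtain ⟨V, hV, hPV⟩ := hP.1
  refine Set.Finite.of_injOn (f := fun u => (P ∩ supportHyperplane P u).extremePoints ℝ)
    (t := V.powerset) (fun u _ => ?_) (fun u hu w hw huw => hP.injOn_normals hu hw ?_)
    hV.finite_subsets
  · refine ((hP.isExposed_inter_supportHyperplane u).isExtreme.extremePoints_subset_extremePoints
      ).trans ?_
    rw [hPV]
    exact extremePoints_convexHull_subset
  · have key : ∀ u, closure (convexHull ℝ ((P ∩ supportHyperplane P u).extremePoints ℝ)) =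
        P ∩ supportHyperplane P u := fun u =>
      closure_convexHull_extremePoints
        ((hP.isExposed_inter_supportHyperplane u).isCompact hP.isCompact)
        ((hP.isExposed_inter_supportHyperplane u).convex hP.convex)
    simp only at huw ⊢
    rw [← key u, huw, key w]

/-- The normals of a polytope positively span the space. -/
lemma IsPolytope.eq_zero_of_forall_inner_le {P : Set (EuclideanSpace ℝ (Fin n))}
    (hP : IsPolytope P) {a : EuclideanSpace ℝ (Fin n)}
    (ha : ∀ u ∈ normals P, inner ℝ u a ≤ 0) : a = 0 := by
  by_contra ha0
  obtain ⟨V, hV, hPV⟩ := hP.1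
  obtain ⟨x₀, hx₀⟩ := hP.2
  have := hV.fintype
  let c : V → EuclideanSpace ℝ (Fin n) := fun y => y - x₀
  have hP_le : ∀ (w : EuclideanSpace ℝ (Fin n)) (r : ℝ), (∀ y : V, inner ℝ w (c y) ≤ r) →
      ∀ x ∈ P, inner ℝ w (x - x₀) ≤ r := by
    intro w r hw x hx
    rw [hPV] at hx
    refine convexHull_min (t := {x | inner ℝ w (x - x₀) ≤ r}) (fun y hy => hw ⟨y, hy⟩) ?_ hx
    have : {x | inner ℝ w (x - x₀) ≤ r} = {x | inner ℝ w x ≤ r + inner ℝ w x₀} := by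
      ext x
      simp [inner_sub_right]
    rw [this]
    exact convex_halfSpace_le (innerSL ℝ w).isLinear _
  have hc : ∀ b, (∀ y, inner ℝ (c y) b ≤ 0) → b = 0 := by
    intro b hb
    by_contra hb0
    have hcont : Continuous fun δ : ℝ => x₀ + δ • b := by fun_prop
    have h1 : ∀ᶠ δ : ℝ in nhds 0, x₀ + δ • b ∈ P :=
      hcont.continuousAt.eventually_mem (by simpa using mem_interior_iff_mem_nhds.mp hx₀)
    obtain ⟨δ, hδ, hδ'⟩ := ((h1.filter_mono nhdsWithin_le_nhds).and
      (self_mem_nhdsWithin : Set.Ioi (0 : ℝ) ∈ nhdsWithin 0 (Set.Ioi 0))).exists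
    have h2 := hP_le b 0 (fun y => by rw [real_inner_comm]; exact hb y) _ hδ
    rw [add_sub_cancel_left, inner_smul_right] at h2
    exact absurd h2 (not_le.mpr (mul_pos hδ' (real_inner_self_pos.mpr hb0)))
  -- `D` is the polar of `P - x₀`, compact because `x₀` is interior to `P`. A vertex `w` of `D`
  -- maximizing `⟨a, ·⟩` becomes a facet normal after scaling, and `⟨w, a⟩ > 0`.
  let D := halfspaceInter c fun _ => 1
  have hD : IsCompact D := isCompact_halfspaceInter hc _
  have h0D : (0 : EuclideanSpace ℝ (Fin n)) ∈ D := fun y => by simp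
  have hexp : IsExposed ℝ D ((innerSL ℝ a).toExposed D) := ContinuousLinearMap.toExposed.isExposed
  have hne : ((innerSL ℝ a).toExposed D).Nonempty := by
    obtain ⟨w, hw, hmax⟩ := hD.exists_isMaxOn ⟨0, h0D⟩ (innerSL ℝ a).continuous.continuousOn
    exact ⟨w, hw, fun y hy => hmax hy⟩
  obtain ⟨w, hw⟩ := (hexp.isCompact hD).extremePoints_nonempty hne
  have hwext := hexp.isExtreme.extremePoints_subset_extremePoints hw
  have hspan := span_tight_eq_top_of_mem_extremePoints hwext
  have hwa : 0 < inner ℝ w a := by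
    obtain ⟨δ, hδ, hδD⟩ := exists_pos_add_smul_mem (d := a) h0D (fun y hy => by simp at hy)
    have := hw.1.2 _ hδD
    simp only [zero_add, innerSL_apply_apply, inner_smul_right] at this
    rw [real_inner_comm]
    exact (mul_pos hδ (real_inner_self_pos.mpr ha0)).trans_le this
  have hw0 : w ≠ 0 := fun h => by simp [h] at hwa
  have hnw : 0 < ‖w‖ := norm_pos_iff.mpr hw0
  have hwle : ∀ x ∈ P, inner ℝ w (x - x₀) ≤ 1 :=
    hP_le w 1 fun y => by rw [real_inner_comm]; exact hwext.1 y
  set T : Set V := {y | inner ℝ (c y) w = 1}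
  obtain ⟨t, ht⟩ : T.Nonempty := by
    rw [Set.nonempty_iff_ne_empty]
    intro h
    rw [h, Set.image_empty, Submodule.span_empty] at hspan
    exact hw0 ((Submodule.mem_bot ℝ).mp (hspan ▸ Submodule.mem_top))
  have hVP : ∀ y : V, (y : EuclideanSpace ℝ (Fin n)) ∈ P := fun y =>
    hPV ▸ subset_convexHull ℝ V y.2
  have hTw : ∀ y ∈ T, inner ℝ w (y : EuclideanSpace ℝ (Fin n)) = 1 + inner ℝ w x₀ := by
    intro y hy
    have : inner ℝ (c y) w = 1 := hy
    rw [real_inner_comm, inner_sub_right] at this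
    linarith
  have hsupp : support P (‖w‖⁻¹ • w) = ‖w‖⁻¹ * (1 + inner ℝ w x₀) := by
    refine support_eq (fun x hx => ?_) ⟨t, hVP t, ?_⟩
    · rw [real_inner_smul_left]
      refine mul_le_mul_of_nonneg_left ?_ (inv_nonneg.mpr hnw.le)
      have := hwle x hx
      rw [inner_sub_right] at this
      linarith
    · rw [real_inner_smul_left, hTw t ht]
  have hTF : ∀ y ∈ T, (y : EuclideanSpace ℝ (Fin n)) ∈ P ∩ supportHyperplane P (‖w‖⁻¹ • w) :=
    fun y hy => ⟨hVP y, by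
      rw [supportHyperplane, Set.mem_ofPred_eq, hsupp, real_inner_smul_left, hTw y hy]⟩
  have hunit : ‖‖w‖⁻¹ • w‖ = 1 := by simp [norm_smul, hnw.ne']
  have hu0 : ‖w‖⁻¹ • w ≠ 0 := fun h => by simp [h] at hunit
  have hnormal : ‖w‖⁻¹ • w ∈ normals P := by
    refine ⟨hunit, ⟨t, hTF t ht⟩, le_antisymm ?_ ?_⟩
    · have h1 := Submodule.finrank_mono (vectorSpan_le_orthogonal
        (F := P ∩ supportHyperplane P (‖w‖⁻¹ • w)) fun x hx => hx.2)
      have h2 := finrank_orthogonal_span_singleton_add_one hu0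
      rw [finrank_euclideanSpace_fin] at h2
      omega
    -- The tight vectors `c y` span the space and differ from `c t` by directions of the face, so
    -- the face has dimension at least `n - 1`.
    · have hle : (⊤ : Submodule ℝ (EuclideanSpace ℝ (Fin n))) ≤
          vectorSpan ℝ (P ∩ supportHyperplane P (‖w‖⁻¹ • w)) ⊔ Submodule.span ℝ {c t} := by
        rw [← hspan, Submodule.span_le]
        rintro _ ⟨y, hy, rfl⟩
        have : c y = ((y : EuclideanSpace ℝ (Fin n)) - t) + c t := by simp [c]
        rw [this]
        exact add_mem (Submodule.mem_sup_left (vsub_mem_vectorSpan ℝ (hTF y hy) (hTF t ht)))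
          (Submodule.mem_sup_right (Submodule.mem_span_singleton_self _))
      have h1 := Submodule.finrank_mono hle
      rw [finrank_top, finrank_euclideanSpace_fin] at h1
      have h2 := Submodule.finrank_add_le_finrank_add_finrank
        (vectorSpan ℝ (P ∩ supportHyperplane P (‖w‖⁻¹ • w))) (Submodule.span ℝ {c t})
      have h3 := finrank_span_singleton (K := ℝ) (v := c t) fun h0 => by
        have : inner ℝ (c t) w = 1 := ht
        simp [h0] at this
      omega
  have := ha _ hnormal
  rw [real_inner_smul_left] at this
  exact absurd this (not_le.mpr (mul_pos (inv_pos.mpr hnw) hwa))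

lemma support_halfspaceInter {ι : Type*} {v : ι → EuclideanSpace ℝ (Fin n)} {h : ι → ℝ}
    (hh : IsIrredundant v h) (i : ι) :
    support (halfspaceInter v h) (v i) = h i := by
  obtain ⟨p, hp, hlt⟩ := hh i
  refine support_eq (fun x hx => hx i) ⟨p, fun j => ?_, hp⟩
  by_cases hj : j = i
  · rw [hj, hp]
  · exact (hlt j hj).le

section

variable {ι : Type*} [Fintype ι] [Nonempty ι] {v : ι → EuclideanSpace ℝ (Fin n)} {h : ι → ℝ}

lemma isPolytope_halfspaceInter (hv : ∀ i, ‖v i‖ = 1)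
    (hpos : ∀ a, (∀ i, inner ℝ (v i) a ≤ 0) → a = 0) (hh : IsIrredundant v h) :
    IsPolytope (halfspaceInter v h) := by
  refine ⟨exists_finite_halfspaceInter_eq_convexHull hpos h, ?_⟩
  obtain ⟨x, hx⟩ := hh.exists_forall_lt fun i h0 => by simpa [h0] using hv i
  exact ⟨x, mem_interior_halfspaceInter hx⟩

/-- Each facet lies in one of the bounding hyperplanes, which fixes its normal up to sign.
Conversely, around its irredundancy point each bounding hyperplane meets no other constraint, so it
carries a facet. -/
lemma normals_halfspaceInter (hv : ∀ i, ‖v i‖ = 1)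
    (hpos : ∀ a, (∀ i, inner ℝ (v i) a ≤ 0) → a = 0) (hh : IsIrredundant v h) :
    normals (halfspaceInter v h) = Set.range v := by
  have hv0 : ∀ i, v i ≠ 0 := fun i h0 => by simpa [h0] using hv i
  have hQ := isPolytope_halfspaceInter hv hpos hh
  obtain ⟨x₀, hx₀⟩ := hh.exists_forall_lt hv0
  apply Set.Subset.antisymm
  · rintro w ⟨hw, ⟨y, hy⟩, hdim⟩
    have hw0 : w ≠ 0 := fun h => by simp [h] at hw
    obtain ⟨i, hi⟩ : ∃ i, ∀ x ∈ halfspaceInter v h ∩ supportHyperplane (halfspaceInter v h) w,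
        inner ℝ (v i) x = h i := by
      by_contra! hcon
      choose x hx hne using hcon
      let N : ℝ := Fintype.card ι
      have hN : 0 < N := by simp [N, Fintype.card_pos]
      -- An average of points of the face, one off each bounding hyperplane, is interior, yet it
      -- lies on a supporting hyperplane.
      let z := ∑ i, N⁻¹ • x i
      have hz : ∀ u r, (∀ i, inner ℝ u (x i) ≤ r) → (∃ i, inner ℝ u (x i) < r) →
          inner ℝ u z < r := by
        intro u r hle hlt
        have h1 : ∑ i, inner ℝ u (x i) < ∑ _i : ι, r :=
          Finset.sum_lt_sum (fun i _ => hle i) (hlt.imp fun i hi => ⟨Finset.mem_univ i, hi⟩)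
        simp only [z, inner_sum, inner_smul_right, ← Finset.mul_sum]
        rw [inv_mul_lt_iff₀ hN]
        simpa [N] using h1
      have hzw : inner ℝ w z = support (halfspaceInter v h) w := by
        have h1 : ∀ i, inner ℝ w (x i) = support (halfspaceInter v h) w := fun i => (hx i).2
        simp only [z, inner_sum, inner_smul_right, h1]
        simp [N]
      have hzint : z ∈ interior (halfspaceInter v h) := mem_interior_halfspaceInter fun i =>
        hz _ _ (fun j => (hx j).1 i) ⟨i, lt_of_le_of_ne ((hx i).1 i) (hne i)⟩
      have hcont : Continuous fun δ : ℝ => z + δ • w := by fun_prop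
      have h1 : ∀ᶠ δ : ℝ in nhds 0, z + δ • w ∈ halfspaceInter v h :=
        hcont.continuousAt.eventually_mem (by simpa using mem_interior_iff_mem_nhds.mp hzint)
      obtain ⟨δ, hδ, hδ'⟩ := ((h1.filter_mono nhdsWithin_le_nhds).and
        (self_mem_nhdsWithin : Set.Ioi (0 : ℝ) ∈ nhdsWithin 0 (Set.Ioi 0))).exists
      have h2 := hQ.inner_le_support w hδ
      rw [inner_add_right, hzw, inner_smul_right, real_inner_self_eq_norm_sq, hw] at h2
      have : 0 < δ := hδ'
      linarith
    have h1 := vectorSpan_eq_orthogonal (hv0 i) hi (by rw [hdim, finrank_euclideanSpace_fin])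
    have h2 := vectorSpan_eq_orthogonal (F := halfspaceInter v h ∩
      supportHyperplane (halfspaceInter v h) w) hw0 (fun x hx => hx.2)
      (by rw [hdim, finrank_euclideanSpace_fin])
    rcases eq_or_eq_neg_of_orthogonal_eq (hv i) hw (h1.symm.trans h2) with rfl | rfl
    · exact ⟨i, rfl⟩
    · exfalso
      have h3 := hQ.inner_le_support (-v i) (interior_subset (mem_interior_halfspaceInter hx₀))
      have h4 : inner ℝ (-v i) y = support (halfspaceInter v h) (-v i) := hy.2
      have h5 := hi y hy
      have h6 := hx₀ i
      rw [inner_neg_left] at h3 h4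
      linarith
  · rintro _ ⟨i, rfl⟩
    obtain ⟨p, hp, hlt⟩ := hh i
    have hpQ : p ∈ halfspaceInter v h := fun j => by
      by_cases hj : j = i
      · rw [hj, hp]
      · exact (hlt j hj).le
    have hs := support_halfspaceInter hh i
    have hpF : p ∈ halfspaceInter v h ∩ supportHyperplane (halfspaceInter v h) (v i) :=
      ⟨hpQ, hp.trans hs.symm⟩
    refine ⟨hv i, ⟨p, hpF⟩, ?_⟩
    have : vectorSpan ℝ (halfspaceInter v h ∩ supportHyperplane (halfspaceInter v h) (v i)) =
        (Submodule.span ℝ {v i})ᗮ := by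
      refine le_antisymm (vectorSpan_le_orthogonal fun x hx => hx.2) fun d hd => ?_
      rw [Submodule.mem_orthogonal_singleton_iff_inner_right] at hd
      obtain ⟨δ, hδ, hδQ⟩ := exists_pos_add_smul_mem (d := d) hpQ fun j hj => by
        by_cases hji : j = i
        · rw [hji, hd]
        · exact absurd hj (hlt j hji).ne
      have hF : p + δ • d ∈ halfspaceInter v h ∩ supportHyperplane (halfspaceInter v h) (v i) :=
        ⟨hδQ, by
          rw [supportHyperplane, Set.mem_ofPred_eq, inner_add_right, inner_smul_right, hd, hp, hs]
          simp⟩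
      have := vsub_mem_vectorSpan ℝ hF hpF
      rw [vsub_eq_sub, add_sub_cancel_left] at this
      exact (Submodule.smul_mem_iff _ hδ.ne').mp this
    rw [this, finrank_orthogonal_span_singleton_add_one (hv0 i), finrank_euclideanSpace_fin]

end

end StrongMonotypy

/-! ### Counting vertices against bases -/

section Counting

variable {E : Type*} [NormedAddCommGroup E] [InnerProductSpace ℝ E]

/-- The points at which the hyperplanes `⟨v i, x⟩ = h i` through the point have normals spanning
the space. -/
def vertexSet {ι : Type*} (v : ι → E) (h : ι → ℝ) : Set E :=
  {x | Submodule.span ℝ (v '' {i | inner ℝ (v i) x = h i}) = ⊤}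

/-- The index sets of the bases contained in the family `v`. -/
def basisSets {ι : Type*} (v : ι → E) : Set (Set ι) :=
  {T | LinearIndepOn ℝ v T ∧ Submodule.span ℝ (v '' T) = ⊤}

lemma LinearIndepOn.exists_inner_eq [FiniteDimensional ℝ E] {ι : Type*} {v : ι → E} {T : Set ι}
    (hT : LinearIndepOn ℝ v T) (r : ι → ℝ) : ∃ x : E, ∀ i ∈ T, inner ℝ (v i) x = r i := by
  have := FiniteDimensional.complete ℝ E
  have hli : LinearIndependent ℝ (fun i : T => v i) := hT
  obtain ⟨g, hg⟩ := LinearMap.exists_extend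
    ((Finsupp.linearCombination ℝ (fun i : T => r i)) ∘ₗ (hli.repr : _ →ₗ[ℝ] T →₀ ℝ))
  refine ⟨(InnerProductSpace.toDual ℝ E).symm (LinearMap.toContinuousLinearMap g), fun i hi => ?_⟩
  rw [real_inner_comm, InnerProductSpace.toDual_symm_apply]
  have h1 := LinearMap.congr_fun hg ⟨v i, Submodule.subset_span ⟨⟨i, hi⟩, rfl⟩⟩
  have h2 := hli.repr_eq_single ⟨i, hi⟩ ⟨v i, Submodule.subset_span ⟨⟨i, hi⟩, rfl⟩⟩ rfl
  simp only [LinearMap.comp_apply, Submodule.subtype_apply, h2] at h1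
  simpa using h1

/-- The right hand sides for which all hyperplanes with index in `T` have a common point. -/
def concurrentSubmodule {ι : Type*} (v : ι → E) (T : Set ι) : Submodule ℝ (ι → ℝ) where
  carrier := {h | ∃ x : E, ∀ i ∈ T, inner ℝ (v i) x = h i}
  add_mem' := by
    rintro g h ⟨x, hx⟩ ⟨y, hy⟩
    exact ⟨x + y, fun i hi => by rw [inner_add_right, hx i hi, hy i hi, Pi.add_apply]⟩
  zero_mem' := ⟨0, fun i _ => by simp⟩
  smul_mem' := by
    rintro t h ⟨x, hx⟩
    exact ⟨t • x, fun i hi => by rw [inner_smul_right, hx i hi, Pi.smul_apply, smul_eq_mul]⟩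

/-- Right hand sides `0` on the basis `S` force the common point to be `0`, which excludes the value
`1` at `i`. -/
lemma concurrentSubmodule_ne_top {ι : Type*} {v : ι → E} {S T : Set ι} (hS : S ∈ basisSets v) {i : ι}
    (hi : i ∉ S) (hiT : i ∈ T) : concurrentSubmodule v (S ∪ T) ≠ ⊤ := by
  classical
  intro htop
  obtain ⟨x, hx⟩ : Pi.single i (1 : ℝ) ∈ concurrentSubmodule v (S ∪ T) := htop ▸ Submodule.mem_top
  have hx0 : x = 0 := eq_zero_of_inner_eq_zero hS.2 (by
    rintro _ ⟨j, hj, rfl⟩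
    have hji : j ≠ i := fun h => hi (h ▸ hj)
    rw [hx j (Or.inl hj), Pi.single_eq_of_ne hji])
  have := hx i (Or.inr hiT)
  simp [hx0] at this

variable {ι : Type*} [Fintype ι]

lemma IsCircuitRelation.neg {V : Type*} [AddCommGroup V] [Module ℝ V] {v : ι → V} {c : ι → ℝ}
    (hc : IsCircuitRelation v c) : IsCircuitRelation v (-c) := by
  refine ⟨neg_ne_zero.mpr hc.ne_zero, by simp [hc.sum_eq_zero], fun c' hc' hs => ?_⟩
  obtain ⟨t, rfl⟩ := hc.eq_smul c' hc' fun i hi => hs i (by simp [hi])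
  exact ⟨-t, by simp⟩

lemma IsCircuitRelation.linearIndepOn {V : Type*} [AddCommGroup V] [Module ℝ V] {v : ι → V}
    {c : ι → ℝ} (hc : IsCircuitRelation v c) {l : ι} (hl : c l ≠ 0) :
    LinearIndepOn ℝ v {m | c m ≠ 0 ∧ m ≠ l} := by
  rw [linearIndepOn_iff]
  intro f hf hsum
  have hf0 : ∀ i, ¬ (c i ≠ 0 ∧ i ≠ l) → f i = 0 := fun i hi => by
    by_contra h
    exact hi ((Finsupp.mem_supported _ _).mp hf (Finsupp.mem_support_iff.mpr h))
  rw [Finsupp.linearCombination_apply, Finsupp.sum_fintype _ _ (by simp)] at hsum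
  obtain ⟨t, ht⟩ := hc.eq_smul f hsum fun i hi => hf0 i (by simp [hi])
  have h1 := congrFun ht l
  rw [hf0 l (by simp), Pi.smul_apply, smul_eq_mul] at h1
  have ht0 : t = 0 := (mul_eq_zero.mp h1.symm).resolve_right hl
  exact DFunLike.coe_injective (by simpa [ht0] using ht)

/-- A circuit with two negative coefficients is violated by some function `max(0, ⟨a, ·⟩)`. -/
lemma IsCircuitRelation.exists_sum_max_neg [FiniteDimensional ℝ E] {v : ι → E} {c : ι → ℝ}
    (hc : IsCircuitRelation v c) {k l : ι} (hkl : k ≠ l) (hk : c k < 0) (hl : c l < 0) :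
    ∃ a : E, ∑ i, c i * max 0 (inner ℝ (v i) a) < 0 := by
  classical
  -- Within the circuit, `a` pairs to `1` with `v k` and to `0` with all others except `v l`, whose
  -- term is nonpositive because `c l < 0`.
  obtain ⟨a, ha⟩ := (hc.linearIndepOn hl.ne).exists_inner_eq (Pi.single k 1)
  refine ⟨a, Finset.sum_neg' (fun i _ => ?_) ⟨k, Finset.mem_univ k, ?_⟩⟩
  · by_cases hil : i = l
    · subst hil
      exact mul_nonpos_of_nonpos_of_nonneg hl.le (le_max_left _ _)
    by_cases hi : c i = 0
    · simp [hi]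
    rw [ha i ⟨hi, hil⟩]
    by_cases hik : i = k
    · subst hik
      simpa using hk.le
    · simp [hik]
  · rw [ha k ⟨hk.ne, hkl⟩]
    simpa using hk

lemma IsCircuitRelation.exists_sum_eq_zero [FiniteDimensional ℝ E] {v : ι → E}
    {c : ι → ℝ} (hc : IsCircuitRelation v c)
    (hpos : ∃ i j, i ≠ j ∧ 0 < c i ∧ 0 < c j) (hneg : ∃ i j, i ≠ j ∧ c i < 0 ∧ c j < 0) :
    ∃ (s t : ℝ) (a b : E), 0 ≤ s ∧ 0 ≤ t ∧
      ∑ i, c i * (1 + s * max 0 (inner ℝ (v i) a) + t * max 0 (inner ℝ (v i) b)) = 0 := by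
  obtain ⟨i, j, hij, hi, hj⟩ := hpos
  obtain ⟨k, l, hkl, hk, hl⟩ := hneg
  obtain ⟨a, ha⟩ := hc.exists_sum_max_neg hkl hk hl
  obtain ⟨b, hb⟩ := hc.neg.exists_sum_max_neg hij (by simpa using hi) (by simpa using hj)
  simp only [Pi.neg_apply, neg_mul, Finset.sum_neg_distrib, neg_lt_zero] at hb
  set A := ∑ i, c i * max 0 (inner ℝ (v i) a)
  set B := ∑ i, c i * max 0 (inner ℝ (v i) b)
  set S := ∑ i, c i
  -- The sum is `S + s * A + t * B` with `A < 0 < B`; these values give `s * A = -|S|` and `t * B =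
  -- |S| - S`.
  refine ⟨|S| / -A, (|S| - S) / B, a, b, div_nonneg (abs_nonneg _) (by linarith),
    div_nonneg (sub_nonneg.mpr (le_abs_self S)) hb.le, ?_⟩
  have : ∀ s t : ℝ, ∑ i, c i * (1 + s * max 0 (inner ℝ (v i) a) + t * max 0 (inner ℝ (v i) b)) =
      S + s * A + t * B := fun s t => by
    simp only [S, A, B, Finset.mul_sum, ← Finset.sum_add_distrib]
    exact Finset.sum_congr rfl fun i _ => by ring
  rw [this, div_neg, neg_mul, div_mul_cancel₀ _ ha.ne, div_mul_cancel₀ _ hb.ne']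
  ring

/-- If the right hand sides satisfy a circuit relation, then two bases define the same vertex. -/
lemma IsCircuitRelation.ncard_vertexSet_lt [FiniteDimensional ℝ E] {v : ι → E}
    (hv : Submodule.span ℝ (Set.range v) = ⊤) (hv0 : ∀ i, v i ≠ 0) {c : ι → ℝ}
    (hc : IsCircuitRelation v c) {h : ι → ℝ} (hh : ∑ i, c i * h i = 0) :
    (vertexSet v h).ncard < (basisSets v).ncard := by
  classical
  have extend : ∀ {s t : Set ι}, LinearIndepOn ℝ v s → s ⊆ t → Submodule.span ℝ (v '' t) = ⊤ →
      ∃ T ∈ basisSets v, T ⊆ t ∧ s ⊆ T := by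
    intro s t hs hst ht
    obtain ⟨T, hTt, hsT, hspan, hT⟩ := exists_linearIndepOn_extension hs hst
    exact ⟨T, ⟨hT, top_le_iff.mp (ht ▸ Submodule.span_le.mpr hspan)⟩, hTt, hsT⟩
  obtain ⟨i, hi⟩ := Function.ne_iff.mp hc.ne_zero
  rw [Pi.zero_apply] at hi
  obtain ⟨T₁, hT₁, -, hsub⟩ := extend (hc.linearIndepOn hi) (Set.subset_univ _)
    (by rw [Set.image_univ, hv])
  obtain ⟨x, hx⟩ := hT₁.1.exists_inner_eq h
  -- The relation holds for the vectors and for `h`, so tightness on the rest of the circuit passes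
  -- to `i`.
  have hxi : inner ℝ (v i) x = h i := by
    have h1 : ∑ j, c j * (inner ℝ (v j) x - h j) = 0 := by
      have h2 : ∑ j, c j * inner ℝ (v j) x = inner ℝ (∑ j, c j • v j) x := by
        rw [sum_inner]
        exact Finset.sum_congr rfl fun j _ => (real_inner_smul_left _ _ _).symm
      simp only [mul_sub, Finset.sum_sub_distrib, hh, h2, hc.sum_eq_zero, inner_zero_left, sub_zero]
    rw [Finset.sum_eq_single i (fun j _ hji => ?_) (by simp)] at h1
    · exact sub_eq_zero.mp ((mul_eq_zero.mp h1).resolve_left hi)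
    · by_cases hj : c j = 0
      · rw [hj, zero_mul]
      · rw [hx j (hsub ⟨hj, hji⟩), sub_self, mul_zero]
  have hiT₁ : i ∉ T₁ := by
    intro hiT
    have h1 := (linearIndepOn_iff.mp hT₁.1) (Finsupp.equivFunOnFinite.symm c) (by
        rw [Finsupp.mem_supported]
        intro j hj
        by_cases hji : j = i
        · exact hji ▸ hiT
        · exact hsub ⟨by simpa using hj, hji⟩) (by
        rw [Finsupp.linearCombination_apply, Finsupp.sum_fintype _ _ (by simp)]
        simpa using hc.sum_eq_zero)
    exact hi (by simpa using DFunLike.congr_fun h1 i)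
  have hxspan : Submodule.span ℝ (v '' {i | inner ℝ (v i) x = h i}) = ⊤ :=
    top_le_iff.mp (hT₁.2 ▸ Submodule.span_mono (Set.image_mono fun j hj => hx j hj))
  obtain ⟨T₂, hT₂, hT₂x, hiT₂⟩ := extend ((linearIndepOn_singleton_iff ℝ).mpr (hv0 i))
    (Set.singleton_subset_iff.mpr hxi) hxspan
  have hne : T₁ ≠ T₂ := fun h => hiT₁ (h ▸ hiT₂ rfl)
  -- Only the vertex `x` could need `T₂`, and there `T₁` serves instead.
  have hex : ∀ y ∈ vertexSet v h, ∃ T ∈ basisSets v \ {T₂}, ∀ j ∈ T, inner ℝ (v j) y = h j := by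
    intro y hy
    obtain ⟨T, hT, hTy, -⟩ := extend (linearIndepOn_empty ℝ v) (Set.empty_subset _) hy
    by_cases hTT : T = T₂
    · have : y = x := eq_of_span_tight_eq_top hT.2 hTy (hTT ▸ hT₂x)
      exact ⟨T₁, ⟨hT₁, hne⟩, this ▸ hx⟩
    · exact ⟨T, ⟨hT, hTT⟩, hTy⟩
  choose! f hf hfy using hex
  calc (vertexSet v h).ncard ≤ (basisSets v \ {T₂}).ncard :=
        Set.ncard_le_ncard_of_injOn f hf (fun y hy z hz hyz =>
          eq_of_span_tight_eq_top (hf y hy).1.2 (hfy y hy) (hyz ▸ hfy z hz)) (Set.toFinite _)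
    _ < (basisSets v).ncard := Set.ncard_sdiff_singleton_lt_of_mem hT₂ (Set.toFinite _)

/-- In a suitable direction, arbitrarily small perturbations of the right hand sides make distinct
bases define distinct vertices. -/
lemma exists_generic_direction [FiniteDimensional ℝ E] (v : ι → E) :
    ∃ g : ι → ℝ, ∀ (h : ι → ℝ) (ε : ℝ), 0 < ε → ∃ δ ∈ Set.Ioo 0 ε,
      (basisSets v).ncard ≤ (vertexSet v (h + δ • g)).ncard := by
  classical
  let 𝒮 : Set (Submodule ℝ (ι → ℝ)) := (fun p : Set ι × Set ι => concurrentSubmodule v (p.1 ∪ p.2)) ''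
    {p | p.1 ∈ basisSets v ∧ p.2 ∈ basisSets v ∧ p.1 ≠ p.2}
  have h𝒮 : 𝒮.Finite := (Set.toFinite _).image _
  have htop : ∀ p ∈ 𝒮, p ≠ ⊤ := by
    rintro _ ⟨⟨S, T⟩, ⟨hS, hT, hne⟩, rfl⟩
    by_cases hTS : T ⊆ S
    · obtain ⟨i, hiS, hiT⟩ := Set.exists_of_ssubset (hTS.ssubset_of_ne hne.symm)
      have := concurrentSubmodule_ne_top (T := S) hT hiT hiS
      rwa [Set.union_comm] at this
    · obtain ⟨i, hiT, hiS⟩ := Set.not_subset.mp hTS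
      exact concurrentSubmodule_ne_top hS hiS hiT
  -- Finitely many proper subspaces do not cover a real vector space.
  have hg : ∃ g : ι → ℝ, ∀ p ∈ 𝒮, g ∉ p := by
    have := Subspace.biUnion_ne_univ_of_top_notMem (s := h𝒮.toFinset)
      fun h => htop _ (h𝒮.mem_toFinset.mp h) rfl
    obtain ⟨g, hg⟩ := (Set.ne_univ_iff_exists_notMem _).mp this
    exact ⟨g, fun p hp hgp => hg (Set.mem_biUnion (by simpa using hp) hgp)⟩
  obtain ⟨g, hg⟩ := hg
  refine ⟨g, fun h ε hε => ?_⟩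
  -- A line whose direction is not in a subspace meets it at most once.
  have hbad : (⋃ p ∈ 𝒮, {δ : ℝ | h + δ • g ∈ p}).Finite := by
    refine h𝒮.biUnion fun p hp => Set.Subsingleton.finite fun δ hδ δ' hδ' => ?_
    by_contra hne
    have h1 := p.sub_mem hδ hδ'
    rw [add_sub_add_left_eq_sub, ← sub_smul] at h1
    exact hg p hp ((p.smul_mem_iff (sub_ne_zero.mpr hne)).mp h1)
  obtain ⟨δ, hδ, hδbad⟩ := ((Set.Ioo_infinite hε).sdiff hbad).nonempty
  refine ⟨δ, hδ, ?_⟩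
  have hex : ∀ T ∈ basisSets v, ∃ x : E, ∀ i ∈ T, inner ℝ (v i) x = (h + δ • g) i := fun T hT =>
    hT.1.exists_inner_eq _
  choose! f hf using hex
  refine Set.ncard_le_ncard_of_injOn f (fun T hT => ?_) (fun S hS T hT hST => ?_)
    (finite_span_tight_eq_top v _)
  · exact top_le_iff.mp (hT.2 ▸ Submodule.span_mono (Set.image_mono fun j hj => hf T hT j hj))
  · by_contra hne
    refine hδbad (Set.mem_biUnion ⟨(S, T), ⟨hS, hT, hne⟩, rfl⟩ ⟨f S, ?_⟩)
    rintro i (hi | hi)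
    · exact hf S hS i hi
    · exact hST ▸ hf T hT i hi

end Counting

/-! ### Moving to further hyperplanes; one-sidedness from constant vertex number -/

section Moving

variable {E : Type*} [NormedAddCommGroup E] [InnerProductSpace ℝ E]

/-- From a point that is not a vertex of a hyperplane arrangement one reaches, without crossing a
hyperplane, a point lying on an additional one. -/
lemma exists_mem_additional_hyperplane [FiniteDimensional ℝ E] {ι : Type*} [Finite ι] {v : ι → E}
    {h : ι → ℝ} (hv : Submodule.span ℝ (Set.range v) = ⊤) {x : E} (hx : x ∉ vertexSet v h) :
    ∃ y : E, (∃ i, inner ℝ (v i) y = h i ∧ inner ℝ (v i) x ≠ h i) ∧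
      ∀ i, inner ℝ (v i) y = h i ∨
        SignType.sign (inner ℝ (v i) y - h i) = SignType.sign (inner ℝ (v i) x - h i) := by
  classical
  have := Fintype.ofFinite ι
  obtain ⟨d₀, hd₀, hd₀x⟩ := exists_ne_zero_inner_eq_zero hx
  obtain ⟨k, hk⟩ : ∃ k, inner ℝ (v k) d₀ ≠ 0 := by
    by_contra! hcon
    exact hd₀ (eq_zero_of_inner_eq_zero hv (by rintro _ ⟨i, rfl⟩; exact hcon i))
  have hkx : inner ℝ (v k) x ≠ h k := fun hkx => hk (hd₀x _ ⟨k, hkx, rfl⟩)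
  obtain ⟨d, hd, hkd⟩ : ∃ d : E, (∀ i, inner ℝ (v i) x = h i → inner ℝ (v i) d = 0) ∧
      0 < (h k - inner ℝ (v k) x) / inner ℝ (v k) d := by
    rcases lt_or_gt_of_ne (div_ne_zero (sub_ne_zero.mpr hkx.symm) hk) with hlt | hgt
    · refine ⟨-d₀, fun i hi => ?_, ?_⟩
      · rw [inner_neg_right, hd₀x _ ⟨i, hi, rfl⟩, neg_zero]
      · rwa [inner_neg_right, div_neg, neg_pos]
    · exact ⟨d₀, fun i hi => hd₀x _ ⟨i, hi, rfl⟩, hgt⟩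
  -- `i₀` indexes the first hyperplane hit when moving from `x` along `d`; nothing is crossed before
  -- it.
  obtain ⟨i₀, hi₀, hmin⟩ := Finset.exists_min_image
    (Finset.univ.filter fun i => 0 < (h i - inner ℝ (v i) x) / inner ℝ (v i) d)
    (fun i => (h i - inner ℝ (v i) x) / inner ℝ (v i) d) ⟨k, by simpa using hkd⟩
  simp only [Finset.mem_filter, Finset.mem_univ, true_and] at hi₀ hmin
  set t := (h i₀ - inner ℝ (v i₀) x) / inner ℝ (v i₀) d with ht
  have hi₀d : inner ℝ (v i₀) d ≠ 0 := fun h0 => by simp [ht, h0] at hi₀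
  refine ⟨x + t • d, ⟨i₀, ?_, fun h0 => hi₀d (hd i₀ h0)⟩, fun i => ?_⟩
  · rw [inner_add_right, inner_smul_right, ht, div_mul_cancel₀ _ hi₀d]
    ring
  · rw [inner_add_right, inner_smul_right]
    set p := inner ℝ (v i) x
    set q := inner ℝ (v i) d
    rcases lt_trichotomy p (h i) with hlt | heq | hgt
    · rcases lt_trichotomy (p + t * q) (h i) with h1 | h1 | h1
      · right
        rw [sign_neg (sub_neg.mpr h1), sign_neg (sub_neg.mpr hlt)]
      · exact Or.inl h1
      · exfalso
        have hq : 0 < q := by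
          by_contra! hq
          have := mul_nonpos_of_nonneg_of_nonpos hi₀.le hq
          linarith
        have := hmin i (div_pos (sub_pos.mpr hlt) hq)
        rw [le_div_iff₀ hq] at this
        linarith
    · left
      have : q = 0 := hd i heq
      rw [this, mul_zero, add_zero, heq]
    · rcases lt_trichotomy (p + t * q) (h i) with h1 | h1 | h1
      · exfalso
        have hq : q < 0 := by
          by_contra! hq
          have := mul_nonneg hi₀.le hq
          linarith
        have := hmin i (div_pos_of_neg_of_neg (sub_neg.mpr hgt) hq)
        rw [le_div_iff_of_neg hq] at this
        linarith
      · exact Or.inl h1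
      · right
        rw [sign_pos (sub_pos.mpr h1), sign_pos (sub_pos.mpr hgt)]

/-- If the number of vertices is the same for all irredundant right hand sides, then the circuits
of the normals are one-sided. -/
theorem hasOneSidedCircuits_of_ncard_vertexSet_eq [FiniteDimensional ℝ E] {ι : Type*} [Fintype ι]
    {v : ι → E} (hv : ∀ i, ‖v i‖ = 1) (hinj : Function.Injective v)
    (hspan : Submodule.span ℝ (Set.range v) = ⊤) (N : ℕ)
    (hN : ∀ h, IsIrredundant v h → (vertexSet v h).ncard = N) : HasOneSidedCircuits v := by
  intro c hc
  by_contra! hcon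
  obtain ⟨⟨i, j, hi, hj, hij⟩, k, l, hk, hl, hkl⟩ := hcon
  obtain ⟨s, t, a, b, hs, ht, hsum⟩ := hc.exists_sum_eq_zero ⟨i, j, hij, hi, hj⟩ ⟨k, l, hkl, hk, hl⟩
  obtain ⟨h, hh, hsum⟩ : ∃ h, IsIrredundant v h ∧ ∑ i, c i * h i = 0 :=
    ⟨_, isIrredundant_one_add_max hv hinj hs ht a b, hsum⟩
  have hlt := hc.ncard_vertexSet_lt hspan (fun u h0 => by simpa [h0] using hv u) hsum
  obtain ⟨g, hg⟩ := exists_generic_direction v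
  obtain ⟨ε, hε, hε'⟩ := Metric.eventually_nhds_iff.mp (hh.eventually_add_smul hv g)
  obtain ⟨δ, hδ, hle⟩ := hg h ε hε
  have hirr := hN _ (hε' (y := δ) (by
    rw [Real.dist_eq, sub_zero, abs_of_pos hδ.1]
    exact hδ.2))
  have := hN _ hh
  omega

end Moving

/-! ### Vertices of facet hyperplane arrangements, and the conclusion -/

namespace StrongMonotypy

variable {n : ℕ}

/-- The vertices of the facet hyperplane arrangement of `Q`. -/
def arrangementVertices (Q : Set (EuclideanSpace ℝ (Fin n))) : Set (EuclideanSpace ℝ (Fin n)) :=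
  vertexSet ((↑) : normals Q → EuclideanSpace ℝ (Fin n)) fun u => support Q u

/-- The faces of the arrangement that are minimal with respect to incidence. -/
def minimalFaces (Q : Set (EuclideanSpace ℝ (Fin n))) : Set (arrangementFaces Q) :=
  {F | ∀ G : arrangementFaces Q, (G : Set (EuclideanSpace ℝ (Fin n))) ⊆ closure F →
    (F : Set (EuclideanSpace ℝ (Fin n))) ⊆ closure G}

lemma self_mem_arrangementFace (Q : Set (EuclideanSpace ℝ (Fin n)))
    (x : EuclideanSpace ℝ (Fin n)) : x ∈ arrangementFace Q x := fun _ _ => rfl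

lemma inner_eq_support_of_mem_closure {Q : Set (EuclideanSpace ℝ (Fin n))}
    {x y u : EuclideanSpace ℝ (Fin n)} (hu : u ∈ normals Q) (hx : inner ℝ u x = support Q u)
    (hy : y ∈ closure (arrangementFace Q x)) : inner ℝ u y = support Q u := by
  have hclosed : IsClosed {y | inner ℝ u y = support Q u} :=
    isClosed_eq (by fun_prop) continuous_const
  refine closure_minimal (fun z hz => ?_) hclosed hy
  have := hz u hu
  rw [hx, sub_self, sign_zero, sign_eq_zero_iff] at this
  exact sub_eq_zero.mp this

/-- On the open segment from a point of the face of `y` to `x`, all signs are those of `x`. -/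
lemma arrangementFace_subset_closure {Q : Set (EuclideanSpace ℝ (Fin n))}
    {x y : EuclideanSpace ℝ (Fin n)} (h : ∀ u ∈ normals Q, inner ℝ u y = support Q u ∨
      SignType.sign (inner ℝ u y - support Q u) = SignType.sign (inner ℝ u x - support Q u)) :
    arrangementFace Q y ⊆ closure (arrangementFace Q x) := by
  intro z hz
  have hc : Continuous fun t : ℝ => z + t • (x - z) := by fun_prop
  have hlim : Filter.Tendsto (fun t : ℝ => z + t • (x - z)) (nhdsWithin 0 (Set.Ioi 0)) (nhds z) := by
    have := (hc.tendsto 0).mono_left (nhdsWithin_le_nhds (s := Set.Ioi 0))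
    simpa using this
  refine mem_closure_of_tendsto hlim ?_
  filter_upwards [Ioo_mem_nhdsGT (zero_lt_one (α := ℝ))] with t ht u hu
  have heq : inner ℝ u (z + t • (x - z)) - support Q u =
      (1 - t) * (inner ℝ u z - support Q u) + t * (inner ℝ u x - support Q u) := by
    rw [inner_add_right, inner_smul_right, inner_sub_right]
    ring
  have h1 : 0 < 1 - t := by linarith [ht.2]
  rw [heq]
  rcases h u hu with h0 | h0
  · have := hz u hu
    rw [h0, sub_self, sign_zero, sign_eq_zero_iff] at this
    rw [this, mul_zero, zero_add, sign_mul, sign_pos ht.1, one_mul]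
  · have h2 := (hz u hu).trans h0
    rcases lt_trichotomy (inner ℝ u x - support Q u) 0 with hs | hs | hs
    · rw [sign_neg hs, sign_eq_neg_one_iff] at h2
      rw [sign_neg hs, sign_eq_neg_one_iff]
      exact add_neg (mul_neg_of_pos_of_neg h1 h2) (mul_neg_of_pos_of_neg ht.1 hs)
    · rw [hs, sign_zero, sign_eq_zero_iff] at h2
      rw [h2, hs, mul_zero, mul_zero, add_zero]
    · rw [sign_pos hs, sign_eq_one_iff] at h2
      rw [sign_pos hs, sign_eq_one_iff]
      exact add_pos (mul_pos h1 h2) (mul_pos ht.1 hs)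

lemma arrangementFace_eq_singleton {Q : Set (EuclideanSpace ℝ (Fin n))}
    {x : EuclideanSpace ℝ (Fin n)} (hx : x ∈ arrangementVertices Q) : arrangementFace Q x = {x} := by
  refine Set.Subset.antisymm (fun y hy => ?_) (Set.singleton_subset_iff.mpr
    (self_mem_arrangementFace Q x))
  exact eq_of_span_tight_eq_top (h := fun u : normals Q => support Q u) hx
    (fun u hu => inner_eq_support_of_mem_closure u.2 hu (subset_closure hy)) (fun u hu => hu)

lemma IsPolytope.span_normals {Q : Set (EuclideanSpace ℝ (Fin n))} (hQ : IsPolytope Q) :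
    Submodule.span ℝ (normals Q) = ⊤ := by
  by_contra hne
  obtain ⟨d, hd0, hd⟩ := exists_ne_zero_inner_eq_zero hne
  exact hd0 (hQ.eq_zero_of_forall_inner_le fun u hu => (hd u hu).le)

/-- The minimal faces of the arrangement are exactly its vertices. -/
lemma IsPolytope.card_minimalFaces {Q : Set (EuclideanSpace ℝ (Fin n))} (hQ : IsPolytope Q) :
    Nat.card (minimalFaces Q) = (arrangementVertices Q).ncard := by
  have := hQ.finite_normals.to_subtype
  rw [← Nat.card_coe_set_eq]
  refine (Nat.card_congr (Equiv.ofBijective (fun x : arrangementVertices Q =>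
    (⟨⟨arrangementFace Q x, x, rfl⟩, ?_⟩ : minimalFaces Q)) ⟨?_, ?_⟩)).symm
  · rintro ⟨_, y, rfl⟩ hG
    simp only [arrangementFace_eq_singleton x.2, closure_singleton] at hG ⊢
    have : y = x := hG (self_mem_arrangementFace Q y)
    rw [← this]
    exact Set.singleton_subset_iff.mpr (subset_closure (self_mem_arrangementFace Q y))
  · intro x y hxy
    simp only [Subtype.mk.injEq, arrangementFace_eq_singleton x.2,
      arrangementFace_eq_singleton y.2, Set.singleton_eq_singleton_iff] at hxy
    exact Subtype.ext hxy
  · rintro ⟨⟨_, x, rfl⟩, hF⟩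
    refine ⟨⟨x, ?_⟩, rfl⟩
    -- From a non-vertex `x`, a face on an additional hyperplane is reached in the closure;
    -- minimality would put `x` on that hyperplane.
    by_contra hx
    obtain ⟨y, ⟨u, huy, hux⟩, hy⟩ := exists_mem_additional_hyperplane
      (by rw [Subtype.range_coe, hQ.span_normals]) hx
    have h1 := hF ⟨arrangementFace Q y, y, rfl⟩
      (arrangementFace_subset_closure fun u hu => hy ⟨u, hu⟩)
    exact hux (inner_eq_support_of_mem_closure u.2 huy (h1 (self_mem_arrangementFace Q x)))

/-- Minimality is expressed by incidence alone, so the bijection of faces restricts to minimal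
faces. -/
lemma ArrangementsEquivalent.ncard_arrangementVertices_eq {P Q : Set (EuclideanSpace ℝ (Fin n))}
    (h : ArrangementsEquivalent P Q) (hP : IsPolytope P) (hQ : IsPolytope Q) :
    (arrangementVertices P).ncard = (arrangementVertices Q).ncard := by
  obtain ⟨e, he⟩ := h
  rw [← hP.card_minimalFaces, ← hQ.card_minimalFaces]
  refine Nat.card_congr (e.subtypeEquiv fun F => ?_)
  simp only [minimalFaces, Set.mem_ofPred_eq]
  rw [← e.forall_congr_right]
  exact forall_congr' fun G => by rw [he, he]

lemma arrangementVertices_halfspaceInter {ι : Type*} [Fintype ι] [Nonempty ι]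
    {v : ι → EuclideanSpace ℝ (Fin n)} {h : ι → ℝ} (hv : ∀ i, ‖v i‖ = 1)
    (hpos : ∀ a, (∀ i, inner ℝ (v i) a ≤ 0) → a = 0) (hh : IsIrredundant v h) :
    arrangementVertices (halfspaceInter v h) = vertexSet v h := by
  have hnorm := normals_halfspaceInter hv hpos hh
  ext x
  have : ((↑) : normals (halfspaceInter v h) → EuclideanSpace ℝ (Fin n)) ''
      {u | inner ℝ (u : EuclideanSpace ℝ (Fin n)) x = support (halfspaceInter v h) u} =
      v '' {i | inner ℝ (v i) x = h i} := by
    ext u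
    constructor
    · rintro ⟨⟨u, hu⟩, hux, rfl⟩
      obtain ⟨i, rfl⟩ := hnorm ▸ hu
      exact ⟨i, hux.trans (support_halfspaceInter hh i), rfl⟩
    · rintro ⟨i, hi, rfl⟩
      exact ⟨⟨v i, hnorm ▸ ⟨i, rfl⟩⟩, hi.trans (support_halfspaceInter hh i).symm, rfl⟩
  simp only [arrangementVertices, vertexSet, Set.mem_ofPred_eq, this]

/-- The circuits of the normals of a strongly monotypic polytope are one-sided. -/
theorem IsStronglyMonotypic.hasOneSidedCircuits {P : Set (EuclideanSpace ℝ (Fin n))}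
    (hP : IsStronglyMonotypic P) [Fintype (normals P)] :
    HasOneSidedCircuits ((↑) : normals P → EuclideanSpace ℝ (Fin n)) := by
  -- Normals are absent only for `n = 0`; the halfspace lemmas need a nonempty family.
  rcases isEmpty_or_nonempty (normals P) with hemp | hne
  · exact fun c _ => Or.inl fun i => hemp.elim i
  have hv : ∀ u : normals P, ‖(u : EuclideanSpace ℝ (Fin n))‖ = 1 := fun u => u.2.1
  have hpos : ∀ a, (∀ u : normals P, inner ℝ (u : EuclideanSpace ℝ (Fin n)) a ≤ 0) → a = 0 :=
    fun a ha => hP.1.eq_zero_of_forall_inner_le fun u hu => ha ⟨u, hu⟩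
  refine hasOneSidedCircuits_of_ncard_vertexSet_eq hv Subtype.coe_injective
    (by rw [Subtype.range_coe, hP.1.span_normals]) (arrangementVertices P).ncard fun h hh => ?_
  have hQ := isPolytope_halfspaceInter hv hpos hh
  rw [← arrangementVertices_halfspaceInter hv hpos hh]
  refine ((hP.2 _ hQ ?_).ncard_arrangementVertices_eq hP.1 hQ).symm
  rw [normals_halfspaceInter hv hpos hh, Subtype.range_coe]

lemma IsPolytope.positivelySpans_normals {P : Set (EuclideanSpace ℝ (Fin n))}
    (hP : IsPolytope P) : PositivelySpans ((↑) : normals P → EuclideanSpace ℝ (Fin n)) := by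
  intro f hf
  set a := (InnerProductSpace.toDual ℝ (EuclideanSpace ℝ (Fin n))).symm
    (LinearMap.toContinuousLinearMap f)
  have hfa : ∀ x, f x = inner ℝ a x := fun x => by
    simp [a, InnerProductSpace.toDual_symm_apply]
  have ha : -a = 0 := hP.eq_zero_of_forall_inner_le fun u hu => by
    have := hf ⟨u, hu⟩
    rw [hfa, real_inner_comm] at this
    rwa [inner_neg_right, neg_nonpos]
  ext x
  rw [hfa, neg_eq_zero.mp ha, inner_zero_left, LinearMap.zero_apply]

end StrongMonotypy

theorem theorem2 (n : ℕ) (P : Set (EuclideanSpace ℝ (Fin n)))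
    (hP : StrongMonotypy.IsStronglyMonotypic P) :
    ∃ (k : ℕ) (Y : Fin k → Set (EuclideanSpace ℝ (Fin n))),
      (∀ i, Y i ⊆ StrongMonotypy.normals P) ∧
      (∀ i j, i ≠ j → Disjoint (Y i) (Y j)) ∧
      (∀ i, StrongMonotypy.IsSimplexAroundZero (Y i)) ∧
      iSupIndep (fun i => Submodule.span ℝ (Y i)) ∧
      DirectSum.IsInternal (fun i => Submodule.span ℝ (Y i)) := by
  have := hP.1.finite_normals.to_subtype
  obtain ⟨_⟩ := nonempty_fintype (StrongMonotypy.normals P)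
  obtain ⟨k, C, hC, hnn, -, hind, hsup⟩ := exists_nonneg_circuit_decomposition _
    hP.hasOneSidedCircuits hP.1.positivelySpans_normals
  let Y : Fin k → Set (EuclideanSpace ℝ (Fin n)) := fun a => (↑) '' {u | C a u ≠ 0}
  have hY : iSupIndep fun a => Submodule.span ℝ (Y a) := hind
  refine ⟨k, Y, ?_, ?_, ?_, hY,
    (DirectSum.isInternal_submodule_iff_iSupIndep_and_iSup_eq_top _).mpr ⟨hY, hsup⟩⟩
  · rintro a _ ⟨u, -, rfl⟩
    exact u.2
  · intro a b hab
    rw [Set.disjoint_left]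
    intro u hua hub
    -- A shared vector lies in two independent spans, so it is zero; normals have norm `1`.
    have h0 : u = 0 := (Submodule.disjoint_def.mp (hY.pairwiseDisjoint hab)) u
      (Submodule.subset_span hua) (Submodule.subset_span hub)
    obtain ⟨w, -, rfl⟩ := hua
    simpa [h0] using w.2.1
  · exact fun a => ⟨(hC a).affineIndependent (hnn a), (hC a).zero_mem_intrinsicInterior (hnn a)⟩
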